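/- For an integer $h\ge 1$ let $R_h$ be the finite set of rays $\rho\subset\mathbb{R}^2$ with apex $0$ whose minimal lattice point $u_\rho\in\mathbb{Z}^2\setminus\{0\}$ (a primitive vector) satisfies $|u_\rho|\le h$, where $|(x,y)|=\max\{|x|,|y|\}$. A fan in $\mathbb{R}^2$ is a finite nonempty set of strongly convex rational polyhedral cones which contains every face of each of its cones and in which the intersection of any two cones is a face of each. For a finite set $S$ of such rays, the completion of $S$ is the maximal fan, with respect to inclusion, whose set of one-dimensional cones is $S$. Let $T(h,p)$ be the probability distribution on fans obtained by choosing each ray of $R_h$ independently with probability $p$ and taking the completion of the set of chosen rays. For a fan $\Sigma$ let $X(\Sigma)$ be the toric variety over $\mathbb{C}$ of $\Sigma$, i.e. the scheme glued from the affine toric varieties $\operatorname{Spec}\mathbb{C}[\sigma^\vee\cap\mathbb{Z}^2]$, $\sigma\in\Sigma$, along common faces; it is called singular if one of its local rings is not regular. Then for every fixed real number $p$ with $0<p<1$, $$\lim_{h\to\infty}\ \mathbb{P}_{\Sigma\sim T(h,p)}\bigl(X(\Sigma)\text{ is singular}\bigr)=1 .$$ -/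

import Mathlib

namespace RandomToric

/-- The inclusion of the lattice `N = ℤ²` into `N_ℝ = ℝ²`. -/
def toReal (u : ℤ × ℤ) : ℝ × ℝ := ((u.1 : ℝ), (u.2 : ℝ))

/-- The pairing of a lattice point `m` of the dual lattice `M = ℤ²` with a vector of `ℝ²`. -/
def pairing (m : ℤ × ℤ) (x : ℝ × ℝ) : ℝ := m.1 * x.1 + m.2 * x.2

/-- The determinant `x ∧ y`. -/
def wedge (x y : ℝ × ℝ) : ℝ := x.1 * y.2 - x.2 * y.1

/-- A rational ray of `ℝ²` with apex `0`, recorded by its minimal lattice point,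
that is, a primitive vector of `ℤ²`. -/
def Ray : Type := {u : ℤ × ℤ // IsCoprime u.1 u.2}

/-- The minimal lattice point `u_ρ` of a ray, as a vector of `ℝ²`. -/
def Ray.vec (ρ : Ray) : ℝ × ℝ := toReal ρ.1

/-- The magnitude `|ρ| = |u_ρ|`, for the maximum norm. -/
def Ray.height (ρ : Ray) : ℤ := max |ρ.1.1| |ρ.1.2|

/-- The ray as a cone in `ℝ²`. -/
def Ray.cone (ρ : Ray) : PointedCone ℝ (ℝ × ℝ) := PointedCone.hull ℝ {ρ.vec}

/-- The cone generated by two rays. -/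
def cone₂ (ρ τ : Ray) : PointedCone ℝ (ℝ × ℝ) := PointedCone.hull ℝ {ρ.vec, τ.vec}

/-- Strongly convex (salient) rational polyhedral cones in `ℝ²`. -/
structure IsToricCone (σ : PointedCone ℝ (ℝ × ℝ)) : Prop where
  rational : ∃ s : Finset (ℤ × ℤ), σ = PointedCone.hull ℝ (toReal '' (s : Set (ℤ × ℤ)))
  salient : σ.toConvexCone.Salient

/-- A fan in `ℝ²`: a finite nonempty set of strongly convex rational polyhedral cones which contains
all faces of its cones and in which the intersection of two cones is a face of each
(by symmetry, it is enough to ask this for the first one). -/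
@[ext]
structure Fan where
  cones : Set (PointedCone ℝ (ℝ × ℝ))
  finite : cones.Finite
  nonempty : cones.Nonempty
  isToricCone : ∀ σ ∈ cones, IsToricCone σ
  face_mem : ∀ σ ∈ cones, ∀ τ : PointedCone ℝ (ℝ × ℝ), τ.IsFaceOf σ → τ ∈ cones
  inf_isFaceOf : ∀ σ ∈ cones, ∀ τ ∈ cones, (σ ⊓ τ).IsFaceOf σ

/-- The set `Σ(1)` of rays (one-dimensional cones) of a fan. -/
def Fan.rays (F : Fan) : Set Ray := {ρ | ρ.cone ∈ F.cones}

theorem mem_hull_one {u x : ℝ × ℝ} : x ∈ PointedCone.hull ℝ {u} ↔ ∃ a : ℝ, 0 ≤ a ∧ a • u = x := by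
  rw [PointedCone.hull, Submodule.mem_span_singleton]
  constructor
  · rintro ⟨a, rfl⟩; exact ⟨a.1, a.2, rfl⟩
  · rintro ⟨a, ha, rfl⟩; exact ⟨⟨a, ha⟩, rfl⟩

theorem mem_hull_two {u v x : ℝ × ℝ} : x ∈ PointedCone.hull ℝ {u, v} ↔
    ∃ a b : ℝ, 0 ≤ a ∧ 0 ≤ b ∧ a • u + b • v = x := by
  rw [PointedCone.hull, Submodule.mem_span_pair]
  constructor
  · rintro ⟨a, b, rfl⟩; exact ⟨a.1, b.1, a.2, b.2, rfl⟩
  · rintro ⟨a, b, ha, hb, rfl⟩; exact ⟨⟨a, ha⟩, ⟨b, hb⟩, rfl⟩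

theorem mem_hull_two_iff {u v x : ℝ × ℝ} (h : 0 < wedge u v) :
    x ∈ PointedCone.hull ℝ {u, v} ↔ 0 ≤ wedge u x ∧ 0 ≤ wedge x v := by
  rw [mem_hull_two]
  constructor
  · rintro ⟨a, b, ha, hb, rfl⟩
    have h1 : wedge u (a • u + b • v) = b * wedge u v := by simp [wedge]; ring
    have h2 : wedge (a • u + b • v) v = a * wedge u v := by simp [wedge]; ring
    rw [h1, h2]; exact ⟨by positivity, by positivity⟩
  · rintro ⟨h1, h2⟩
    refine ⟨wedge x v / wedge u v, wedge u x / wedge u v, by positivity, by positivity, ?_⟩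
    ext
    · simp; field_simp; simp [wedge]; ring
    · simp; field_simp; simp [wedge]; ring

theorem smul_mem_real {σ : PointedCone ℝ (ℝ × ℝ)} {x : ℝ × ℝ} {a : ℝ} (ha : 0 ≤ a) (hx : x ∈ σ) :
    a • x ∈ σ := PointedCone.smul_mem σ ha hx

theorem of_smul_mem {σ : PointedCone ℝ (ℝ × ℝ)} {x : ℝ × ℝ} {a : ℝ} (ha : 0 < a)
    (hx : a • x ∈ σ) : x ∈ σ := by
  have := smul_mem_real (inv_nonneg.2 ha.le) hx
  rwa [smul_smul, inv_mul_cancel₀ ha.ne', one_smul] at this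

theorem Ray.vec_ne_zero (ρ : Ray) : ρ.vec ≠ 0 := by
  intro h
  obtain ⟨⟨a, b⟩, hab⟩ := ρ
  simp [Ray.vec, toReal] at h
  obtain ⟨rfl, rfl⟩ := h
  exact not_isCoprime_zero_zero hab

theorem Ray.vec_mem_cone (ρ : Ray) : ρ.vec ∈ ρ.cone := PointedCone.subset_hull (by simp)

theorem Ray.mem_cone {ρ : Ray} {x : ℝ × ℝ} : x ∈ ρ.cone ↔ ∃ a : ℝ, 0 ≤ a ∧ a • ρ.vec = x :=
  mem_hull_one

theorem Ray.cone_le {ρ : Ray} {σ : PointedCone ℝ (ℝ × ℝ)} : ρ.cone ≤ σ ↔ ρ.vec ∈ σ := by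
  simp [Ray.cone, PointedCone.hull, Submodule.span_le]

theorem cone₂_le {ρ τ : Ray} {σ : PointedCone ℝ (ℝ × ℝ)} :
    cone₂ ρ τ ≤ σ ↔ ρ.vec ∈ σ ∧ τ.vec ∈ σ := by
  simp [cone₂, PointedCone.hull, Submodule.span_le, Set.insert_subset_iff]

theorem vec_left_mem (ρ τ : Ray) : ρ.vec ∈ cone₂ ρ τ := PointedCone.subset_hull (by simp)

theorem vec_right_mem (ρ τ : Ray) : τ.vec ∈ cone₂ ρ τ := PointedCone.subset_hull (by simp)

theorem mem_cone₂ {ρ τ : Ray} (h : 0 < wedge ρ.vec τ.vec) {x : ℝ × ℝ} :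
    x ∈ cone₂ ρ τ ↔ 0 ≤ wedge ρ.vec x ∧ 0 ≤ wedge x τ.vec := mem_hull_two_iff h

theorem exists_smul_of_wedge {u v : ℝ × ℝ} (hu : u ≠ 0) (h : wedge u v = 0) :
    ∃ c : ℝ, v = c • u := by
  obtain ⟨a, b⟩ := u
  obtain ⟨x, y⟩ := v
  simp only [wedge] at h
  by_cases ha : a = 0
  · subst ha
    have hb : b ≠ 0 := fun hb => hu (by simp [hb])
    have hx : x = 0 := by
      rcases mul_eq_zero.1 (show b * x = 0 by linarith) with h | h
      · exact absurd h hb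
      · exact h
    exact ⟨y / b, by ext <;> simp [hx, hb]⟩
  · refine ⟨x / a, ?_⟩
    ext
    · simp [ha]
    · simp; field_simp; linarith

/-- A primitive vector that is a positive multiple of another one equals it. -/
theorem Ray.eq_of_smul {ρ τ : Ray} {a : ℝ} (ha : 0 ≤ a) (h : a • ρ.vec = τ.vec) : ρ = τ := by
  obtain ⟨⟨x, y⟩, i, j, hij⟩ := ρ
  obtain ⟨⟨z, w⟩, k, l, hkl⟩ := τ
  simp only [Ray.vec, toReal, Prod.smul_mk, smul_eq_mul, Prod.mk.injEq] at h hij hkl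
  obtain ⟨h1, h2⟩ := h
  have hij' : (i : ℝ) * x + j * y = 1 := by exact_mod_cast hij
  have hkl' : (k : ℝ) * z + l * w = 1 := by exact_mod_cast hkl
  have e1 : a = ((i * z + j * w : ℤ) : ℝ) := by
    push_cast
    linear_combination -(a * hij') + (i : ℝ) * h1 + (j : ℝ) * h2
  have e2 : a * ((k * x + l * y : ℤ) : ℝ) = 1 := by
    push_cast
    linear_combination hkl' + (k : ℝ) * h1 + (l : ℝ) * h2
  rw [e1] at e2
  have e3 : (i * z + j * w) * (k * x + l * y) = 1 := by exact_mod_cast e2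
  have e4 : 0 ≤ i * z + j * w := by rw [e1] at ha; exact_mod_cast ha
  have e5 : i * z + j * w = 1 := Int.eq_one_of_mul_eq_one_right e4 e3
  rw [e5] at e1
  subst e1
  apply Subtype.ext
  simp only [Int.cast_one, one_mul, Int.cast_inj] at h1 h2
  simp [h1, h2]

theorem Ray.cone_injective : Function.Injective Ray.cone := by
  intro ρ τ h
  have : τ.vec ∈ ρ.cone := h ▸ τ.vec_mem_cone
  obtain ⟨a, ha, h⟩ := Ray.mem_cone.1 this
  exact Ray.eq_of_smul ha h

/-- A nonzero lattice point is a positive multiple of a primitive one. -/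
theorem exists_ray {w : ℤ × ℤ} (hw : w ≠ 0) : ∃ (ρ : Ray) (a : ℝ), 0 < a ∧ toReal w = a • ρ.vec := by
  obtain ⟨x, y⟩ := w
  have hg : 0 < Int.gcd x y := by
    rw [Int.gcd_pos_iff]
    by_contra! h
    exact hw (by simp [h])
  refine ⟨⟨(x / Int.gcd x y, y / Int.gcd x y), ?_⟩, Int.gcd x y, by exact_mod_cast hg, ?_⟩
  · exact Int.isCoprime_iff_gcd_eq_one.2 (Int.gcd_ediv_gcd_ediv_gcd hg)
  · have h1 : ((x / (Int.gcd x y : ℤ) : ℤ) : ℝ) * Int.gcd x y = x := by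
      exact_mod_cast Int.ediv_mul_cancel (Int.gcd_dvd_left x y)
    have h2 : ((y / (Int.gcd x y : ℤ) : ℤ) : ℝ) * Int.gcd x y = y := by
      exact_mod_cast Int.ediv_mul_cancel (Int.gcd_dvd_right x y)
    ext
    · simp [toReal, Ray.vec]; linarith
    · simp [toReal, Ray.vec]; linarith

theorem smul_pos_pt_mem (w : ℝ × ℝ) {a : ℝ} (ha : 0 < a) :
    PointedCone.hull ℝ {a • w} = PointedCone.hull ℝ {w} := by
  apply le_antisymm
  · simp only [Submodule.span_le, Set.singleton_subset_iff]
    exact smul_mem_real ha.le (PointedCone.subset_hull (by simp))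
  · simp only [Submodule.span_le, Set.singleton_subset_iff]
    exact of_smul_mem ha (PointedCone.subset_hull (by simp))

/-- Strongly convex rational cones in the plane: the origin, the rays, and the cones spanned by
two independent rays. -/
theorem IsToricCone.cases {σ : PointedCone ℝ (ℝ × ℝ)} (hσ : IsToricCone σ) :
    σ = ⊥ ∨ (∃ ρ : Ray, σ = ρ.cone) ∨ ∃ ρ τ : Ray, 0 < wedge ρ.vec τ.vec ∧ σ = cone₂ ρ τ := by
  obtain ⟨⟨s, rfl⟩, hs⟩ := hσ
  induction s using Finset.induction_on with
  | empty => left; simp [PointedCone.hull]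
  | insert w s _ ih =>
    rw [Finset.coe_insert, Set.image_insert_eq] at hs ⊢
    have hle : PointedCone.hull ℝ (toReal '' (s : Set (ℤ × ℤ))) ≤
      PointedCone.hull ℝ (insert (toReal w) (toReal '' (s : Set (ℤ × ℤ)))) :=
      Submodule.span_mono (Set.subset_insert _ _)
    have ih := ih (fun x hx h0 h => hs x (hle hx) h0 (hle h))
    rw [PointedCone.hull, Submodule.span_insert, ← PointedCone.hull, ← PointedCone.hull] at hs ⊢
    by_cases hw : w = 0
    · subst hw
      have : PointedCone.hull ℝ {toReal 0} = ⊥ := by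
        have : toReal 0 = 0 := by simp [toReal]
        simp [PointedCone.hull, this]
      rwa [this, bot_sup_eq]
    obtain ⟨ω, a, ha, hω⟩ := exists_ray hw
    rw [hω, smul_pos_pt_mem _ ha] at hs ⊢
    change _ ∨ _ ∨ _
    change (ConvexCone.Salient (PointedCone.toConvexCone (ω.cone ⊔ _))) at hs
    rw [show PointedCone.hull ℝ {ω.vec} = ω.cone from rfl]
    obtain h | ⟨ρ, h⟩ | ⟨ρ, τ, hρτ, h⟩ := ih
    · rw [h, sup_bot_eq]; exact Or.inr (Or.inl ⟨ω, rfl⟩)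
    · rw [h] at hs ⊢
      have e1 : ω.cone ⊔ ρ.cone = cone₂ ω ρ := by
        rw [cone₂, PointedCone.hull, Submodule.span_insert]; rfl
      have e2 : ω.cone ⊔ ρ.cone = cone₂ ρ ω := by
        rw [cone₂, PointedCone.hull, Submodule.span_insert, sup_comm]; rfl
      rcases lt_trichotomy (wedge ω.vec ρ.vec) 0 with hlt | heq | hgt
      · exact Or.inr (Or.inr ⟨ρ, ω, by simp only [wedge] at hlt ⊢; linarith, e2⟩)
      · obtain ⟨c, hc⟩ := exists_smul_of_wedge ω.vec_ne_zero heq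
        have hω : ω.vec ∈ ω.cone ⊔ ρ.cone := le_sup_left (a := ω.cone) ω.vec_mem_cone
        have hρ : ρ.vec ∈ ω.cone ⊔ ρ.cone := le_sup_right (b := ρ.cone) ρ.vec_mem_cone
        rcases le_or_gt 0 c with h0 | h0
        · refine Or.inr (Or.inl ⟨ω, sup_eq_left.2 (Ray.cone_le.2 ?_)⟩)
          rw [hc]
          exact smul_mem_real h0 ω.vec_mem_cone
        · refine absurd ?_ (hs ω.vec hω ω.vec_ne_zero)
          change -ω.vec ∈ ω.cone ⊔ ρ.cone
          refine of_smul_mem (a := -c) (by linarith) ?_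
          rwa [neg_smul_neg, ← hc]
      · exact Or.inr (Or.inr ⟨ω, ρ, hgt, e1⟩)
    · rw [h] at hs ⊢
      have hω : ω.vec ∈ ω.cone ⊔ cone₂ ρ τ := le_sup_left (a := ω.cone) ω.vec_mem_cone
      have hneg : wedge ω.vec ρ.vec = - wedge ρ.vec ω.vec := by simp only [wedge]; ring
      have hneg' : wedge τ.vec ω.vec = - wedge ω.vec τ.vec := by simp only [wedge]; ring
      have hcontra : ¬ (wedge ρ.vec ω.vec ≤ 0 ∧ wedge ω.vec τ.vec ≤ 0) := by
        rintro ⟨hA, hB⟩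
        refine hs ω.vec hω ω.vec_ne_zero ?_
        refine le_sup_right (b := cone₂ ρ τ) ((mem_cone₂ hρτ).2 ⟨?_, ?_⟩)
        · simp only [wedge, Prod.fst_neg, Prod.snd_neg] at hA ⊢; linarith
        · simp only [wedge, Prod.fst_neg, Prod.snd_neg] at hB ⊢; linarith
      rcases le_or_gt 0 (wedge ρ.vec ω.vec) with hA | hA <;>
        rcases le_or_gt 0 (wedge ω.vec τ.vec) with hB | hB
      · exact Or.inr (Or.inr ⟨ρ, τ, hρτ, sup_eq_right.2 (Ray.cone_le.2 ((mem_cone₂ hρτ).2 ⟨hA, hB⟩))⟩)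
      · have hA' : 0 < wedge ρ.vec ω.vec := by
          by_contra h; exact hcontra ⟨by linarith, hB.le⟩
        refine Or.inr (Or.inr ⟨ρ, ω, hA', le_antisymm (sup_le ?_ ?_) ?_⟩)
        · exact Ray.cone_le.2 (vec_right_mem _ _)
        · exact cone₂_le.2 ⟨vec_left_mem _ _, (mem_cone₂ hA').2 ⟨hρτ.le, by linarith⟩⟩
        · exact cone₂_le.2 ⟨le_sup_right (b := cone₂ ρ τ) (vec_left_mem _ _), hω⟩
      · have hB' : 0 < wedge ω.vec τ.vec := by
          by_contra h; exact hcontra ⟨hA.le, by linarith⟩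
        refine Or.inr (Or.inr ⟨ω, τ, hB', le_antisymm (sup_le ?_ ?_) ?_⟩)
        · exact Ray.cone_le.2 (vec_left_mem _ _)
        · exact cone₂_le.2 ⟨(mem_cone₂ hB').2 ⟨by linarith, hρτ.le⟩, vec_right_mem _ _⟩
        · exact cone₂_le.2 ⟨hω, le_sup_right (b := cone₂ ρ τ) (vec_right_mem _ _)⟩
      · exact absurd ⟨hA.le, hB.le⟩ hcontra

/-! ### Faces -/

theorem eq_bot_or_of_isFaceOf_ray {F : PointedCone ℝ (ℝ × ℝ)} {ρ : Ray} (h : F.IsFaceOf ρ.cone) :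
    F = ⊥ ∨ F = ρ.cone := by
  by_cases hρ : ρ.vec ∈ F
  · exact Or.inr (le_antisymm h.le (Ray.cone_le.2 hρ))
  · refine Or.inl (eq_bot_iff.2 fun x hx => ?_)
    obtain ⟨a, ha, rfl⟩ := Ray.mem_cone.1 (h.le hx)
    rcases ha.eq_or_lt with rfl | ha
    · simp
    · exact absurd (of_smul_mem ha hx) hρ

theorem of_isFaceOf_cone₂ {F : PointedCone ℝ (ℝ × ℝ)} {ρ τ : Ray} (h : F.IsFaceOf (cone₂ ρ τ)) :
    F = ⊥ ∨ F = ρ.cone ∨ F = τ.cone ∨ F = cone₂ ρ τ := by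
  have key : ∀ x ∈ F, ∃ a b : ℝ, 0 ≤ a ∧ 0 ≤ b ∧ a • ρ.vec + b • τ.vec = x ∧
      (0 < a → ρ.vec ∈ F) ∧ (0 < b → τ.vec ∈ F) := by
    intro x hx
    obtain ⟨a, b, ha, hb, rfl⟩ := mem_hull_two.1 (h.le hx)
    have h1 := smul_mem_real ha (vec_left_mem ρ τ)
    have h2 := smul_mem_real hb (vec_right_mem ρ τ)
    exact ⟨a, b, ha, hb, rfl, fun ha => of_smul_mem ha (h.mem_of_add_mem_left h1 h2 hx),
      fun hb => of_smul_mem hb (h.mem_of_add_mem_right h1 h2 hx)⟩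
  by_cases hρ : ρ.vec ∈ F <;> by_cases hτ : τ.vec ∈ F
  · exact Or.inr (Or.inr (Or.inr (le_antisymm h.le (cone₂_le.2 ⟨hρ, hτ⟩))))
  · refine Or.inr (Or.inl (le_antisymm (fun x hx => ?_) (Ray.cone_le.2 hρ)))
    obtain ⟨a, b, ha, hb, rfl, -, h2⟩ := key x hx
    have : b = 0 := le_antisymm (not_lt.1 fun hb => hτ (h2 hb)) hb
    simpa [this] using smul_mem_real ha ρ.vec_mem_cone
  · refine Or.inr (Or.inr (Or.inl (le_antisymm (fun x hx => ?_) (Ray.cone_le.2 hτ))))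
    obtain ⟨a, b, ha, hb, rfl, h1, -⟩ := key x hx
    have : a = 0 := le_antisymm (not_lt.1 fun ha => hρ (h1 ha)) ha
    simpa [this] using smul_mem_real hb τ.vec_mem_cone
  · refine Or.inl (eq_bot_iff.2 fun x hx => ?_)
    obtain ⟨a, b, ha, hb, rfl, h1, h2⟩ := key x hx
    have e1 : a = 0 := le_antisymm (not_lt.1 fun ha => hρ (h1 ha)) ha
    have e2 : b = 0 := le_antisymm (not_lt.1 fun hb => hτ (h2 hb)) hb
    simp [e1, e2]

theorem isFaceOf_ray_left {ρ τ : Ray} (h : 0 < wedge ρ.vec τ.vec) :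
    ρ.cone.IsFaceOf (cone₂ ρ τ) := by
  refine ⟨Ray.cone_le.2 (vec_left_mem _ _), ?_⟩
  rintro x y a hx hy ha hxy
  obtain ⟨b, c, hb, hc, rfl⟩ := mem_hull_two.1 hx
  obtain ⟨b', c', hb', hc', rfl⟩ := mem_hull_two.1 hy
  obtain ⟨d, hd, e⟩ := Ray.mem_cone.1 hxy
  have e' : (a * c + c') * wedge ρ.vec τ.vec = 0 := by
    have := congrArg (wedge ρ.vec) e
    simp only [wedge, Prod.fst_add, Prod.snd_add, Prod.smul_fst, Prod.smul_snd, smul_eq_mul]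
      at this ⊢
    linear_combination -this
  have : a * c + c' = 0 := by
    rcases mul_eq_zero.1 e' with h0 | h0
    · exact h0
    · exact absurd h0 h.ne'
  have hc0 : c = 0 := by
    by_contra hne
    have : 0 < a * c := mul_pos ha (lt_of_le_of_ne hc (Ne.symm hne))
    linarith
  simpa [hc0] using smul_mem_real hb ρ.vec_mem_cone

theorem isFaceOf_ray_right {ρ τ : Ray} (h : 0 < wedge ρ.vec τ.vec) :
    τ.cone.IsFaceOf (cone₂ ρ τ) := by
  refine ⟨Ray.cone_le.2 (vec_right_mem _ _), ?_⟩
  rintro x y a hx hy ha hxy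
  obtain ⟨b, c, hb, hc, rfl⟩ := mem_hull_two.1 hx
  obtain ⟨b', c', hb', hc', rfl⟩ := mem_hull_two.1 hy
  obtain ⟨d, hd, e⟩ := Ray.mem_cone.1 hxy
  have e' : (a * b + b') * wedge ρ.vec τ.vec = 0 := by
    have := congrArg (fun z => wedge z τ.vec) e
    simp only [wedge, Prod.fst_add, Prod.snd_add, Prod.smul_fst, Prod.smul_snd, smul_eq_mul]
      at this ⊢
    linear_combination -this
  have : a * b + b' = 0 := by
    rcases mul_eq_zero.1 e' with h0 | h0
    · exact h0
    · exact absurd h0 h.ne'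
  have hc0 : b = 0 := by
    by_contra hne
    have : 0 < a * b := mul_pos ha (lt_of_le_of_ne hb (Ne.symm hne))
    linarith
  simpa [hc0] using smul_mem_real hc τ.vec_mem_cone

/-- A face of a strongly convex rational cone is cut out by a lattice point of the dual cone. -/
theorem IsToricCone.exists_pairing {σ F : PointedCone ℝ (ℝ × ℝ)} (hσ : IsToricCone σ)
    (h : F.IsFaceOf σ) : ∃ m : ℤ × ℤ, (∀ x ∈ σ, 0 ≤ pairing m x) ∧
      ∀ x ∈ σ, x ∈ F ↔ pairing m x = 0 := by
  obtain rfl | ⟨ρ, rfl⟩ | ⟨ρ, τ, hρτ, rfl⟩ := hσ.cases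
  · have : F = ⊥ := eq_bot_iff.2 h.le
    subst this
    exact ⟨0, by simp [pairing], by simp [pairing]⟩
  · obtain rfl | rfl := eq_bot_or_of_isFaceOf_ray h
    · have hpos : 0 < pairing ρ.1 ρ.vec := by
        have h0 := ρ.vec_ne_zero
        have : pairing ρ.1 ρ.vec = ρ.vec.1 ^ 2 + ρ.vec.2 ^ 2 := by
          simp [pairing, Ray.vec, toReal]; ring
        rw [this]
        by_contra hle
        apply h0
        ext
        · exact pow_eq_zero_iff two_ne_zero |>.1
            (by nlinarith [sq_nonneg ρ.vec.1, sq_nonneg ρ.vec.2])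
        · exact pow_eq_zero_iff two_ne_zero |>.1
            (by nlinarith [sq_nonneg ρ.vec.1, sq_nonneg ρ.vec.2])
      have hs : ∀ a : ℝ, pairing ρ.1 (a • ρ.vec) = a * pairing ρ.1 ρ.vec := by
        intro a; simp [pairing]; ring
      refine ⟨ρ.1, ?_, ?_⟩
      · intro x hx
        obtain ⟨a, ha, rfl⟩ := Ray.mem_cone.1 hx
        rw [hs]; positivity
      · intro x hx
        obtain ⟨a, ha, rfl⟩ := Ray.mem_cone.1 hx
        rw [hs]
        simp [hpos.ne', ρ.vec_ne_zero]
    · exact ⟨0, by simp [pairing], fun x hx => by simpa [pairing] using hx⟩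
  · have p1 : ∀ x, pairing (-ρ.1.2, ρ.1.1) x = wedge ρ.vec x := by
      intro x; simp [pairing, wedge, Ray.vec, toReal]; ring
    have p2 : ∀ x, pairing (τ.1.2, -τ.1.1) x = wedge x τ.vec := by
      intro x; simp [pairing, wedge, Ray.vec, toReal]; ring
    have padd : ∀ m m' x, pairing (m + m') x = pairing m x + pairing m' x := by
      intro m m' x; simp [pairing]; ring
    have w1 : ∀ a b : ℝ, wedge ρ.vec (a • ρ.vec + b • τ.vec) = b * wedge ρ.vec τ.vec := by
      intro a b; simp [wedge]; ring
    have w2 : ∀ a b : ℝ, wedge (a • ρ.vec + b • τ.vec) τ.vec = a * wedge ρ.vec τ.vec := by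
      intro a b; simp [wedge]; ring
    obtain rfl | rfl | rfl | rfl := of_isFaceOf_cone₂ h
    · refine ⟨(-ρ.1.2, ρ.1.1) + (τ.1.2, -τ.1.1), fun x hx => ?_, fun x hx => ?_⟩
      · rw [padd, p1, p2]
        have := (mem_cone₂ hρτ).1 hx
        linarith
      · rw [padd, p1, p2]
        obtain ⟨a, b, ha, hb, rfl⟩ := mem_hull_two.1 hx
        constructor
        · intro h
          rw [Submodule.mem_bot] at h
          rw [h]; simp [wedge]
        · rw [w1, w2, ← add_mul]
          intro h
          rcases mul_eq_zero.1 h with h | h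
          · have ha : a = 0 := by linarith
            have hb : b = 0 := by linarith
            simp [ha, hb]
          · exact absurd h hρτ.ne'
    · refine ⟨(-ρ.1.2, ρ.1.1), fun x hx => ?_, fun x hx => ?_⟩
      · rw [p1]; exact ((mem_cone₂ hρτ).1 hx).1
      · rw [p1]
        obtain ⟨a, b, ha, hb, rfl⟩ := mem_hull_two.1 hx
        constructor
        · intro h
          obtain ⟨c, hc, h⟩ := Ray.mem_cone.1 h
          rw [← h]; simp [wedge]; ring
        · rw [w1]
          intro h
          rcases mul_eq_zero.1 h with h | h
          · simpa [h] using smul_mem_real ha ρ.vec_mem_cone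
          · exact absurd h hρτ.ne'
    · refine ⟨(τ.1.2, -τ.1.1), fun x hx => ?_, fun x hx => ?_⟩
      · rw [p2]; exact ((mem_cone₂ hρτ).1 hx).2
      · rw [p2]
        obtain ⟨a, b, ha, hb, rfl⟩ := mem_hull_two.1 hx
        constructor
        · intro h
          obtain ⟨c, hc, h⟩ := Ray.mem_cone.1 h
          rw [← h]; simp [wedge]; ring
        · rw [w2]
          intro h
          rcases mul_eq_zero.1 h with h | h
          · simpa [h] using smul_mem_real hb τ.vec_mem_cone
          · exact absurd h hρτ.ne'
    · exact ⟨0, by simp [pairing], fun x hx => by simpa [pairing] using hx⟩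

/-! ### The completion of a set of rays -/

/-- The cones of the completion of a set `S` of rays: the origin, the rays in `S`, and the cones
spanned by two rays of `S` at an angle less than `π` with no ray of `S` strictly in between. -/
def completionCones (S : Set Ray) : Set (PointedCone ℝ (ℝ × ℝ)) :=
  {σ | σ = ⊥ ∨ (∃ ρ ∈ S, σ = ρ.cone) ∨ ∃ ρ ∈ S, ∃ τ ∈ S, 0 < wedge ρ.vec τ.vec ∧
    (∀ ω ∈ S, ¬ (0 < wedge ρ.vec ω.vec ∧ 0 < wedge ω.vec τ.vec)) ∧ σ = cone₂ ρ τ}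

theorem completionCones_finite {S : Set Ray} (hS : S.Finite) : (completionCones S).Finite := by
  refine (((Set.finite_singleton ⊥).union (hS.image Ray.cone)).union
    ((hS.prod hS).image fun p => cone₂ p.1 p.2)).subset ?_
  rintro σ (rfl | ⟨ρ, hρ, rfl⟩ | ⟨ρ, hρ, τ, hτ, -, -, rfl⟩)
  · exact Or.inl (Or.inl rfl)
  · exact Or.inl (Or.inr ⟨ρ, hρ, rfl⟩)
  · exact Or.inr ⟨(ρ, τ), ⟨hρ, hτ⟩, rfl⟩

theorem isToricCone_bot : IsToricCone ⊥ where
  rational := ⟨∅, by simp [PointedCone.hull]⟩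
  salient := by
    intro x hx h0
    exact absurd hx h0

theorem isToricCone_ray (ρ : Ray) : IsToricCone ρ.cone where
  rational := ⟨{ρ.1}, by simp [Ray.cone, Ray.vec]⟩
  salient := by
    intro x hx h0 hx'
    obtain ⟨a, ha, rfl⟩ := Ray.mem_cone.1 hx
    obtain ⟨b, hb, h⟩ := Ray.mem_cone.1 hx'
    have : (a + b) • ρ.vec = 0 := by rw [add_smul, h, add_neg_cancel]
    rcases smul_eq_zero.1 this with h | h
    · exact h0 (by simp [show a = 0 by linarith])
    · exact ρ.vec_ne_zero h

theorem isToricCone_cone₂ {ρ τ : Ray} (h : 0 < wedge ρ.vec τ.vec) : IsToricCone (cone₂ ρ τ) where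
  rational := ⟨{ρ.1, τ.1}, by simp [cone₂, Ray.vec, Set.image_insert_eq]⟩
  salient := by
    intro x hx h0 hx'
    obtain ⟨h1, h2⟩ := (mem_cone₂ h).1 hx
    obtain ⟨h3, h4⟩ := (mem_cone₂ h).1 hx'
    have e1 : wedge ρ.vec (-x) = - wedge ρ.vec x := by simp [wedge]; ring
    have e2 : wedge (-x) τ.vec = - wedge x τ.vec := by simp [wedge]; ring
    rw [e1] at h3
    rw [e2] at h4
    obtain ⟨c, rfl⟩ := exists_smul_of_wedge ρ.vec_ne_zero (show wedge ρ.vec x = 0 by linarith)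
    have e3 : wedge (c • ρ.vec) τ.vec = c * wedge ρ.vec τ.vec := by simp [wedge]; ring
    rw [e3] at h2 h4
    have : c * wedge ρ.vec τ.vec = 0 := by linarith
    rcases mul_eq_zero.1 this with hc | hc
    · exact h0 (by simp [hc])
    · exact h.ne' hc

theorem eq_bot_of_isFaceOf_bot {F : PointedCone ℝ (ℝ × ℝ)} (h : F.IsFaceOf ⊥) : F = ⊥ :=
  eq_bot_iff.2 h.le

theorem completionCones_face {S : Set Ray} {σ : PointedCone ℝ (ℝ × ℝ)} (hσ : σ ∈ completionCones S)
    {F : PointedCone ℝ (ℝ × ℝ)} (h : F.IsFaceOf σ) : F ∈ completionCones S := by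
  obtain rfl | ⟨ρ, hρ, rfl⟩ | ⟨ρ, hρ, τ, hτ, h0, hS, rfl⟩ := hσ
  · exact Or.inl (eq_bot_of_isFaceOf_bot h)
  · rcases eq_bot_or_of_isFaceOf_ray h with rfl | rfl
    · exact Or.inl rfl
    · exact Or.inr (Or.inl ⟨ρ, hρ, rfl⟩)
  · obtain rfl | rfl | rfl | rfl := of_isFaceOf_cone₂ h
    · exact Or.inl rfl
    · exact Or.inr (Or.inl ⟨ρ, hρ, rfl⟩)
    · exact Or.inr (Or.inl ⟨τ, hτ, rfl⟩)
    · exact Or.inr (Or.inr ⟨ρ, hρ, τ, hτ, h0, hS, rfl⟩)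

theorem cone₂_le_of_interior {S : Set Ray} {ρ τ : Ray}
    (hS : ∀ ω ∈ S, ¬ (0 < wedge ρ.vec ω.vec ∧ 0 < wedge ω.vec τ.vec)) (h : 0 < wedge ρ.vec τ.vec)
    {z : ℝ × ℝ} (hz1 : 0 < wedge ρ.vec z) (hz2 : 0 < wedge z τ.vec)
    {σ : PointedCone ℝ (ℝ × ℝ)} (hσ : σ ∈ completionCones S) (hz : z ∈ σ) : cone₂ ρ τ ≤ σ := by
  obtain rfl | ⟨ω, hω, rfl⟩ | ⟨ρ', hρ', τ', hτ', h', hS', rfl⟩ := hσ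
  · rw [Submodule.mem_bot] at hz
    simp [hz, wedge] at hz1
  · obtain ⟨c, hc, rfl⟩ := Ray.mem_cone.1 hz
    have e1 : wedge ρ.vec (c • ω.vec) = c * wedge ρ.vec ω.vec := by simp [wedge]; ring
    have e2 : wedge (c • ω.vec) τ.vec = c * wedge ω.vec τ.vec := by simp [wedge]; ring
    rw [e1] at hz1
    rw [e2] at hz2
    exact absurd ⟨pos_of_mul_pos_right hz1 hc, pos_of_mul_pos_right hz2 hc⟩ (hS ω hω)
  · obtain ⟨h1, h2⟩ := (mem_cone₂ h').1 hz
    have pl : ∀ a b c d : ℝ × ℝ,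
        wedge a b * wedge c d - wedge a c * wedge b d + wedge a d * wedge b c = 0 := by
      intro a b c d; simp only [wedge]; ring
    have anti : ∀ a b : ℝ × ℝ, wedge a b = - wedge b a := by
      intro a b; simp only [wedge]; ring
    have k1 : 0 ≤ wedge ρ'.vec ρ.vec := by
      by_contra hneg
      have hpos : 0 < wedge ρ.vec ρ'.vec := by rw [anti]; linarith
      refine hS ρ' hρ' ⟨hpos, ?_⟩
      have e := pl ρ.vec ρ'.vec z τ.vec
      have a1 := mul_pos hpos hz2
      have a2 := mul_nonneg h.le h1
      exact pos_of_mul_pos_right (show 0 < wedge ρ.vec z * wedge ρ'.vec τ.vec by linarith) hz1.le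
    have k2 : 0 ≤ wedge τ.vec τ'.vec := by
      by_contra hneg
      have hpos : 0 < wedge τ'.vec τ.vec := by rw [anti]; linarith
      refine hS τ' hτ' ⟨?_, hpos⟩
      have e := pl ρ.vec z τ'.vec τ.vec
      have a1 := mul_pos hz1 hpos
      have a2 := mul_nonneg h.le h2
      exact pos_of_mul_pos_left (show 0 < wedge ρ.vec τ'.vec * wedge z τ.vec by linarith) hz2.le
    have k3 : 0 ≤ wedge ρ.vec τ'.vec := by
      have e := pl ρ'.vec ρ.vec z τ'.vec
      have a1 := mul_nonneg k1 h2
      have a2 := mul_pos h' hz1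
      exact (pos_of_mul_pos_right
        (show 0 < wedge ρ'.vec z * wedge ρ.vec τ'.vec by linarith) h1).le
    have k4 : 0 ≤ wedge ρ'.vec τ.vec := by
      have e := pl ρ'.vec z τ.vec τ'.vec
      have a1 := mul_nonneg h1 k2
      have a2 := mul_pos h' hz2
      exact (pos_of_mul_pos_left
        (show 0 < wedge ρ'.vec τ.vec * wedge z τ'.vec by linarith) h2).le
    exact cone₂_le.2 ⟨(mem_cone₂ h').2 ⟨k1, k3⟩, (mem_cone₂ h').2 ⟨k4, k2⟩⟩

theorem completionCones_inf {S : Set Ray} {σ τ : PointedCone ℝ (ℝ × ℝ)}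
    (hσ : σ ∈ completionCones S) (hτ : τ ∈ completionCones S) : (σ ⊓ τ).IsFaceOf σ := by
  have ray : ∀ (ρ : Ray) {x y : ℝ × ℝ} {a : ℝ}, x ∈ ρ.cone → y ∈ ρ.cone → 0 < a →
      a • x + y ∈ τ → x ∈ τ := by
    intro ρ x y a hx hy ha hxy
    obtain ⟨b, hb, rfl⟩ := Ray.mem_cone.1 hx
    obtain ⟨c, hc, rfl⟩ := Ray.mem_cone.1 hy
    rw [smul_smul, ← add_smul] at hxy
    rcases hb.eq_or_lt with rfl | hb
    · simp
    · exact smul_mem_real hb.le (of_smul_mem (by positivity) hxy)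
  refine ⟨inf_le_left, ?_⟩
  rintro x y a hx hy ha ⟨hz, hz'⟩
  refine ⟨hx, ?_⟩
  obtain rfl | ⟨ρ, hρ, rfl⟩ | ⟨ρ, hρ, ω, hω, h0, hS, rfl⟩ := hσ
  · rw [SetLike.mem_coe, Submodule.mem_bot] at *
    rw [hx]; exact τ.zero_mem
  · exact ray ρ hx hy ha hz'
  · obtain ⟨h1, h2⟩ := (mem_cone₂ h0).1 hz
    rcases h1.eq_or_lt with h1 | h1
    · obtain ⟨c, hc⟩ := exists_smul_of_wedge ρ.vec_ne_zero h1.symm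
      have e3 : wedge (c • ρ.vec) ω.vec = c * wedge ρ.vec ω.vec := by simp [wedge]; ring
      rw [hc, e3] at h2
      have hzr : a • x + y ∈ ρ.cone := Ray.mem_cone.2 ⟨c, nonneg_of_mul_nonneg_left h2 h0, hc.symm⟩
      have hf := isFaceOf_ray_left h0
      have hax := smul_mem_real ha.le hx
      exact ray ρ (hf.mem_of_smul_add_mem hx hy ha hzr) (hf.mem_of_add_mem_right hax hy hzr) ha hz'
    rcases h2.eq_or_lt with h2 | h2
    · have h2' : wedge ω.vec (a • x + y) = 0 := by simp only [wedge] at h2 ⊢; linarith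
      obtain ⟨c, hc⟩ := exists_smul_of_wedge ω.vec_ne_zero h2'
      have e3 : wedge ρ.vec (c • ω.vec) = c * wedge ρ.vec ω.vec := by simp [wedge]; ring
      rw [hc, e3] at h1
      have hzr : a • x + y ∈ ω.cone :=
        Ray.mem_cone.2 ⟨c, nonneg_of_mul_nonneg_left h1.le h0, hc.symm⟩
      have hf := isFaceOf_ray_right h0
      have hax := smul_mem_real ha.le hx
      exact ray ω (hf.mem_of_smul_add_mem hx hy ha hzr) (hf.mem_of_add_mem_right hax hy hzr) ha hz'
    · exact cone₂_le_of_interior hS h0 h1 h2 hτ hz' hx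

/-- The completion of a finite set `S` of rays: the maximal fan whose set of rays is `S`
(see `isGreatest_completion`). -/
def completion (S : Set Ray) (hS : S.Finite) : Fan where
  cones := completionCones S
  finite := completionCones_finite hS
  nonempty := ⟨⊥, Or.inl rfl⟩
  isToricCone := by
    rintro σ (rfl | ⟨ρ, hρ, rfl⟩ | ⟨ρ, hρ, τ, hτ, h, -, rfl⟩)
    · exact isToricCone_bot
    · exact isToricCone_ray ρ
    · exact isToricCone_cone₂ h
  face_mem _ hσ _ h := completionCones_face hσ h
  inf_isFaceOf _ hσ _ hτ := completionCones_inf hσ hτ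

theorem rays_completion (S : Set Ray) (hS : S.Finite) : (completion S hS).rays = S := by
  ext ρ
  constructor
  · rintro (h | ⟨τ, hτ, h⟩ | ⟨τ, hτ, ω, hω, h0, -, h⟩)
    · have := ρ.vec_mem_cone
      rw [h, Submodule.mem_bot] at this
      exact absurd this ρ.vec_ne_zero
    · rwa [Ray.cone_injective h]
    · have h1 := vec_left_mem τ ω
      have h2 := vec_right_mem τ ω
      rw [← h] at h1 h2
      obtain ⟨a, -, ha⟩ := Ray.mem_cone.1 h1
      obtain ⟨b, -, hb⟩ := Ray.mem_cone.1 h2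
      rw [← ha, ← hb] at h0
      simp only [wedge, Prod.smul_fst, Prod.smul_snd, smul_eq_mul] at h0
      exact absurd h0 (by nlinarith)
  · intro h
    exact Or.inr (Or.inl ⟨ρ, h, rfl⟩)

theorem cones_subset_completion (F : Fan) (S : Set Ray) (hS : S.Finite) (hF : F.rays = S) :
    F.cones ⊆ (completion S hS).cones := by
  subst hF
  intro σ hσ
  obtain rfl | ⟨ρ, rfl⟩ | ⟨ρ, τ, h, rfl⟩ := (F.isToricCone σ hσ).cases
  · exact Or.inl rfl
  · exact Or.inr (Or.inl ⟨ρ, hσ, rfl⟩)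
  · refine Or.inr (Or.inr ⟨ρ, F.face_mem _ hσ _ (isFaceOf_ray_left h), τ,
      F.face_mem _ hσ _ (isFaceOf_ray_right h), h, ?_, rfl⟩)
    rintro ω hω ⟨h1, h2⟩
    have hmem : ω.vec ∈ cone₂ ρ τ := (mem_cone₂ h).2 ⟨h1.le, h2.le⟩
    have hf := F.inf_isFaceOf _ hσ _ hω
    rw [inf_eq_right.2 (Ray.cone_le.2 hmem)] at hf
    obtain h | h | h | h := of_isFaceOf_cone₂ hf
    · have := ω.vec_mem_cone
      rw [h, Submodule.mem_bot] at this
      exact absurd this ω.vec_ne_zero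
    · rw [Ray.cone_injective h] at h1
      simp [wedge, mul_comm] at h1
    · rw [Ray.cone_injective h] at h2
      simp [wedge, mul_comm] at h2
    · have h3 := vec_left_mem ρ τ
      rw [← h] at h3
      obtain ⟨a, -, ha⟩ := Ray.mem_cone.1 h3
      rw [← ha] at h1
      simp [wedge] at h1
      linarith

/-- Fans are ordered by inclusion. -/
instance : PartialOrder Fan := PartialOrder.lift Fan.cones fun _ _ h => Fan.ext h

/-- The completion of `S` is the largest fan, hence the unique maximal one, among all fans whose set
of rays is `S`. -/
theorem isGreatest_completion (S : Set Ray) (hS : S.Finite) :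
    IsGreatest {F : Fan | F.rays = S} (completion S hS) :=
  ⟨rays_completion S hS, fun F hF => cones_subset_completion F S hS hF⟩

/-! ### The toric variety of a fan -/

theorem pairing_add (m m' : ℤ × ℤ) (x : ℝ × ℝ) :
    pairing (m + m') x = pairing m x + pairing m' x := by
  simp [pairing]; ring

theorem pairing_nsmul (n : ℕ) (m : ℤ × ℤ) (x : ℝ × ℝ) :
    pairing (n • m) x = n * pairing m x := by
  simp [pairing]; ring

/-- The semigroup `S_σ = σ^∨ ∩ M` of lattice points of the dual cone. -/
def dualMonoid (σ : PointedCone ℝ (ℝ × ℝ)) : AddSubmonoid (ℤ × ℤ) where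
  carrier := {m | ∀ x ∈ σ, 0 ≤ pairing m x}
  zero_mem' := by simp [pairing]
  add_mem' := by
    intro m m' hm hm' x hx
    rw [pairing_add]
    exact add_nonneg (hm x hx) (hm' x hx)

theorem dualMonoid_anti {σ τ : PointedCone ℝ (ℝ × ℝ)} (h : τ ≤ σ) : dualMonoid σ ≤ dualMonoid τ :=
  fun _ hm x hx => hm x (h hx)

/-- The semigroup algebra `ℂ[S_σ]`. -/
abbrev CoordRing (σ : PointedCone ℝ (ℝ × ℝ)) : Type := AddMonoidAlgebra ℂ (dualMonoid σ)

/-- The inclusion `ℂ[S_σ] → ℂ[S_τ]` for `τ ⊆ σ`. -/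
noncomputable def coordRingMap {σ τ : PointedCone ℝ (ℝ × ℝ)} (h : τ ≤ σ) :
    CoordRing σ →+* CoordRing τ :=
  AddMonoidAlgebra.mapDomainRingHom ℂ (AddSubmonoid.inclusion (dualMonoid_anti h))

theorem coordRingMap_refl (σ : PointedCone ℝ (ℝ × ℝ)) :
    coordRingMap (le_refl σ) = RingHom.id _ := by
  have : AddSubmonoid.inclusion (dualMonoid_anti (le_refl σ)) = AddMonoidHom.id _ := rfl
  rw [coordRingMap, this]
  exact AddMonoidAlgebra.mapDomainRingHom_id

theorem coordRingMap_comp {σ τ υ : PointedCone ℝ (ℝ × ℝ)} (h : τ ≤ σ) (h' : υ ≤ τ) :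
    (coordRingMap h').comp (coordRingMap h) = coordRingMap (h'.trans h) :=
  (AddMonoidAlgebra.mapDomainRingHom_comp _ _).symm

theorem coordRingMap_injective {σ τ : PointedCone ℝ (ℝ × ℝ)} (h : τ ≤ σ) :
    Function.Injective (coordRingMap h) :=
  AddMonoidAlgebra.mapDomain_injective (AddSubmonoid.inclusion_injective (dualMonoid_anti h))

theorem coordRingMap_single {σ τ : PointedCone ℝ (ℝ × ℝ)} (h : τ ≤ σ) (m : dualMonoid σ) (c : ℂ) :
    coordRingMap h (AddMonoidAlgebra.single m c) =
      AddMonoidAlgebra.single ⟨m.1, dualMonoid_anti h m.2⟩ c :=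
  AddMonoidAlgebra.mapDomain_single

/-- If `m` cuts out the face `τ` of `σ`, then `S_τ = S_σ + ℕ (-m)`. -/
theorem exists_nsmul_add_mem {σ τ : PointedCone ℝ (ℝ × ℝ)} (hσ : IsToricCone σ) {m : ℤ × ℤ}
    (hm : m ∈ dualMonoid σ) (hτ : ∀ x ∈ σ, x ∈ τ ↔ pairing m x = 0) {w : ℤ × ℤ}
    (hw : w ∈ dualMonoid τ) : ∃ n : ℕ, ∀ k ≥ n, k • m + w ∈ dualMonoid σ := by
  obtain ⟨s, rfl⟩ := hσ.rational
  have hev : ∀ᶠ k : ℕ in Filter.atTop, ∀ g ∈ s, 0 ≤ pairing (k • m + w) (toReal g) := by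
    rw [Filter.eventually_all_finset]
    intro g hg
    have hgσ : toReal g ∈ PointedCone.hull ℝ (toReal '' (s : Set (ℤ × ℤ))) :=
      PointedCone.subset_hull ⟨g, hg, rfl⟩
    rcases (hm _ hgσ).eq_or_lt with h0 | hpos
    · refine Filter.Eventually.of_forall fun k => ?_
      rw [pairing_add, pairing_nsmul, ← h0, mul_zero, zero_add]
      exact hw _ ((hτ _ hgσ).2 h0.symm)
    · have ht : Filter.Tendsto (fun k : ℕ => (k : ℝ) * pairing m (toReal g)) Filter.atTop
          Filter.atTop := tendsto_natCast_atTop_atTop.atTop_mul_const hpos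
      filter_upwards [ht.eventually_ge_atTop (-pairing w (toReal g))] with k hk
      rw [pairing_add, pairing_nsmul]
      linarith
  obtain ⟨n, hn⟩ := Filter.eventually_atTop.1 hev
  refine ⟨n, fun k hk x hx => ?_⟩
  induction hx using Submodule.span_induction with
  | mem x hx => obtain ⟨g, hg, rfl⟩ := hx; exact hn k hk g hg
  | zero => simp [pairing]
  | add x y _ _ hx hy =>
    have : pairing (k • m + w) (x + y) = pairing (k • m + w) x + pairing (k • m + w) y := by
      simp only [pairing, Prod.fst_add, Prod.snd_add]; ring
    rw [this]; exact add_nonneg hx hy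
  | smul a x _ hx =>
    have : pairing (k • m + w) (a • x) = a.1 * pairing (k • m + w) x := by
      change pairing (k • m + w) (a.1 • x) = _
      simp only [pairing, Prod.smul_fst, Prod.smul_snd, smul_eq_mul]; ring
    rw [this]; exact mul_nonneg a.2 hx

/-- If `m` cuts out the face `τ` of `σ`, then `ℂ[S_τ]` is the localization of `ℂ[S_σ]` at the
character of `m`. -/
theorem isLocalization_coordRingMap {σ τ : PointedCone ℝ (ℝ × ℝ)} (hσ : IsToricCone σ) (h : τ ≤ σ)
    {m : ℤ × ℤ} (hm : m ∈ dualMonoid σ) (hτ : ∀ x ∈ σ, x ∈ τ ↔ pairing m x = 0) :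
    @IsLocalization.Away (CoordRing σ) _ (AddMonoidAlgebra.single ⟨m, hm⟩ 1) (CoordRing τ) _
      (coordRingMap h).toAlgebra := by
  algebraize [coordRingMap h]
  have hmap : algebraMap (CoordRing σ) (CoordRing τ) = coordRingMap h := rfl
  have hneg : -m ∈ dualMonoid τ := by
    intro x hx
    have : pairing (-m) x = - pairing m x := by simp [pairing]; ring
    rw [this, (hτ x (h hx)).1 hx, neg_zero]
  have hpow : ∀ n : ℕ, (AddMonoidAlgebra.single (⟨m, hm⟩ : dualMonoid σ) (1 : ℂ)) ^ n =
      AddMonoidAlgebra.single (n • (⟨m, hm⟩ : dualMonoid σ)) 1 := by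
    intro n; rw [AddMonoidAlgebra.single_pow, one_pow]
  refine (isLocalization_iff _ _).2 ⟨?_, ?_, ?_⟩
  · rintro ⟨_, n, rfl⟩
    simp only [map_pow]
    refine IsUnit.pow _ (IsUnit.of_mul_eq_one (AddMonoidAlgebra.single ⟨-m, hneg⟩ 1) ?_)
    rw [hmap, coordRingMap_single, AddMonoidAlgebra.single_mul_single, AddMonoidAlgebra.one_def]
    congr 1
    · ext <;> simp
    · simp
  · intro z
    suffices H : ∃ n : ℕ, ∀ k ≥ n, ∃ f : CoordRing σ,
        z * coordRingMap h (AddMonoidAlgebra.single (k • (⟨m, hm⟩ : dualMonoid σ)) 1) =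
          coordRingMap h f by
      obtain ⟨n, hn⟩ := H
      obtain ⟨f, hf⟩ := hn n le_rfl
      exact ⟨(f, ⟨_, n, rfl⟩), by simp only [hpow]; exact hf⟩
    induction z using AddMonoidAlgebra.induction_linear with
    | zero => exact ⟨0, fun k _ => ⟨0, by simp⟩⟩
    | add x y hx hy =>
      obtain ⟨n, hn⟩ := hx
      obtain ⟨n', hn'⟩ := hy
      refine ⟨max n n', fun k hk => ?_⟩
      obtain ⟨f, hf⟩ := hn k (le_of_max_le_left hk)
      obtain ⟨f', hf'⟩ := hn' k (le_of_max_le_right hk)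
      exact ⟨f + f', by rw [add_mul, hf, hf', map_add]⟩
    | single w c =>
      obtain ⟨n, hn⟩ := exists_nsmul_add_mem hσ hm hτ w.2
      refine ⟨n, fun k hk => ⟨AddMonoidAlgebra.single ⟨k • m + w.1, hn k hk⟩ c, ?_⟩⟩
      rw [coordRingMap_single, coordRingMap_single, AddMonoidAlgebra.single_mul_single, mul_one]
      congr 1
      ext <;> simp [add_comm]
  · intro x y hxy
    exact ⟨1, by rw [coordRingMap_injective h hxy]⟩

open CategoryTheory AlgebraicGeometry

/-- The affine toric variety `U_σ = Spec ℂ[S_σ]`. -/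
noncomputable def affineToric (σ : PointedCone ℝ (ℝ × ℝ)) : Scheme.{0} :=
  Spec (CommRingCat.of (CoordRing σ))

/-- The morphism `U_τ → U_σ` for `τ ⊆ σ`. -/
noncomputable def affineToricMap {σ τ : PointedCone ℝ (ℝ × ℝ)} (h : τ ≤ σ) :
    affineToric τ ⟶ affineToric σ :=
  Spec.map (CommRingCat.ofHom (coordRingMap h))

theorem affineToricMap_refl (σ : PointedCone ℝ (ℝ × ℝ)) :
    affineToricMap (le_refl σ) = 𝟙 (affineToric σ) := by
  unfold affineToricMap affineToric
  rw [coordRingMap_refl, CommRingCat.ofHom_id, Spec.map_id]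

theorem affineToricMap_comp {σ τ υ : PointedCone ℝ (ℝ × ℝ)} (h : τ ≤ σ) (h' : υ ≤ τ) :
    affineToricMap h' ≫ affineToricMap h = affineToricMap (h'.trans h) := by
  unfold affineToricMap affineToric
  rw [← Spec.map_comp, ← CommRingCat.ofHom_comp, coordRingMap_comp]

/-- The diagram of the affine toric varieties of the cones of a fan, along the inclusions of
cones. -/
noncomputable def Fan.diagram (F : Fan) : F.cones ⥤ Scheme.{0} where
  obj σ := affineToric σ.1
  map f := affineToricMap f.le
  map_id σ := affineToricMap_refl σ.1
  map_comp f g := (affineToricMap_comp g.le f.le).symm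

theorem Fan.isFaceOf (F : Fan) {σ τ : F.cones} (h : τ ≤ σ) : τ.1.IsFaceOf σ.1 := by
  have := F.inf_isFaceOf _ σ.2 _ τ.2
  rwa [inf_eq_right.2 (show τ.1 ≤ σ.1 from h)] at this

theorem isOpenImmersion_affineToricMap {σ τ : PointedCone ℝ (ℝ × ℝ)} (hσ : IsToricCone σ)
    (h : τ.IsFaceOf σ) : IsOpenImmersion (affineToricMap h.le) := by
  obtain ⟨m, hm, hτ⟩ := hσ.exists_pairing h
  algebraize [coordRingMap h.le]
  have := isLocalization_coordRingMap hσ h.le hm hτ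
  exact IsOpenImmersion.of_isLocalization (AddMonoidAlgebra.single (⟨m, hm⟩ : dualMonoid σ) (1 : ℂ))

theorem mem_range_affineToricMap {σ τ : PointedCone ℝ (ℝ × ℝ)} (hσ : IsToricCone σ) (h : τ ≤ σ)
    {m : ℤ × ℤ} (hm : m ∈ dualMonoid σ) (hτ : ∀ x ∈ σ, x ∈ τ ↔ pairing m x = 0)
    (x : affineToric σ) : x ∈ Set.range (affineToricMap h) ↔
      AddMonoidAlgebra.single (⟨m, hm⟩ : dualMonoid σ) (1 : ℂ) ∉
        PrimeSpectrum.asIdeal (R := CoordRing σ) x := by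
  algebraize [coordRingMap h]
  have := isLocalization_coordRingMap hσ h hm hτ
  exact Set.ext_iff.1 (PrimeSpectrum.localization_away_comap_range (CoordRing τ)
    (AddMonoidAlgebra.single (⟨m, hm⟩ : dualMonoid σ) (1 : ℂ))) x

instance (F : Fan) {σ τ : F.cones} (f : τ ⟶ σ) : IsOpenImmersion (F.diagram.map f) :=
  isOpenImmersion_affineToricMap (F.isToricCone _ σ.2) (F.isFaceOf f.le)

/-- For two faces `τ`, `υ` of `σ`, the intersection of `U_τ` and `U_υ` in `U_σ` is `U_{τ ∩ υ}`. -/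
theorem exists_affineToricMap_eq {σ τ υ : PointedCone ℝ (ℝ × ℝ)} (hσ : IsToricCone σ)
    (hτ : τ.IsFaceOf σ) (hυ : υ.IsFaceOf σ) (x : affineToric τ) (y : affineToric υ)
    (hxy : affineToricMap hτ.le x = affineToricMap hυ.le y) :
    ∃ z : affineToric (τ ⊓ υ), affineToricMap (inf_le_left : τ ⊓ υ ≤ τ) z = x ∧
      affineToricMap (inf_le_right : τ ⊓ υ ≤ υ) z = y := by
  obtain ⟨m, hm, hmi⟩ := hσ.exists_pairing hτ
  obtain ⟨m', hm', hmj⟩ := hσ.exists_pairing hυ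
  have hmm : m + m' ∈ dualMonoid σ := add_mem (show m ∈ dualMonoid σ from hm) hm'
  have hl : ∀ x ∈ σ, x ∈ τ ⊓ υ ↔ pairing (m + m') x = 0 := by
    intro x hx
    have h1 := hm x hx
    have h2 := hm' x hx
    rw [pairing_add, Submodule.mem_inf, hmi x hx, hmj x hx]
    constructor
    · rintro ⟨h, h'⟩; rw [h, h', add_zero]
    · intro h; constructor <;> linarith
  have r1 := mem_range_affineToricMap hσ hτ.le hm hmi
  have r2 := mem_range_affineToricMap hσ hυ.le hm' hmj
  have r3 := mem_range_affineToricMap hσ (inf_le_left.trans hτ.le) hmm hl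
  have hmem : affineToricMap hτ.le x ∈
      Set.range (affineToricMap (inf_le_left.trans hτ.le : τ ⊓ υ ≤ σ)) := by
    rw [r3]
    have e : AddMonoidAlgebra.single (⟨m + m', hmm⟩ : dualMonoid σ) (1 : ℂ) =
        AddMonoidAlgebra.single (⟨m, hm⟩ : dualMonoid σ) 1 *
          AddMonoidAlgebra.single (⟨m', hm'⟩ : dualMonoid σ) 1 := by
      rw [AddMonoidAlgebra.single_mul_single, mul_one]; rfl
    rw [e]
    refine fun hmul => ((PrimeSpectrum.isPrime (R := CoordRing σ) _).mem_or_mem hmul).elim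
      ((r1 _).1 ⟨x, rfl⟩) ((r2 _).1 ?_)
    rw [hxy]
    exact ⟨y, rfl⟩
  obtain ⟨z, hz⟩ := hmem
  have o1 := isOpenImmersion_affineToricMap hσ hτ
  have o2 := isOpenImmersion_affineToricMap hσ hυ
  refine ⟨z, ?_, ?_⟩
  · apply (affineToricMap hτ.le).isOpenEmbedding.injective
    rw [← Scheme.Hom.comp_apply, affineToricMap_comp]
    exact hz
  · apply (affineToricMap hυ.le).isOpenEmbedding.injective
    rw [← hxy, ← Scheme.Hom.comp_apply, affineToricMap_comp]
    exact hz

instance (F : Fan) : (F.diagram ⋙ Scheme.forget).IsLocallyDirected where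
  cond := by
    intro i j k fi fj xi xj hx
    obtain ⟨z, hz1, hz2⟩ := exists_affineToricMap_eq (F.isToricCone _ k.2) (F.isFaceOf fi.le)
      (F.isFaceOf fj.le) xi xj hx
    let l : F.cones := ⟨i.1 ⊓ j.1, F.face_mem _ i.2 _ (F.inf_isFaceOf _ i.2 _ j.2)⟩
    exact ⟨l, homOfLE (inf_le_left : i.1 ⊓ j.1 ≤ i.1), homOfLE (inf_le_right : i.1 ⊓ j.1 ≤ j.1),
      z, hz1, hz2⟩

/-- The toric variety `X(Σ)` over `ℂ`: the affine toric varieties `U_σ` of the cones `σ` of the fan,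
glued along the open immersions `U_τ → U_σ` for the faces `τ` of `σ`. -/
noncomputable def toricVariety (F : Fan) : Scheme.{0} := Limits.colimit F.diagram

/-- A scheme is singular if one of its local rings is not regular. -/
def IsSingular (X : Scheme.{0}) : Prop := ∃ x : X, ¬ IsRegularLocalRing (X.presheaf.stalk x)

/-! ### Random fans -/

/-- The rays of magnitude at most `h`. -/
def raysUpTo (h : ℕ) : Set Ray := {ρ | ρ.height ≤ h}

instance (h : ℕ) : Finite (raysUpTo h) := by
  refine Finite.of_injective
    (β := (Set.Icc (-(h : ℤ)) h ×ˢ Set.Icc (-(h : ℤ)) h : Set (ℤ × ℤ)))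
    (fun ρ => ⟨ρ.1.1, ?_⟩) ?_
  · have := ρ.2
    simp only [raysUpTo, Ray.height, Set.mem_ofPred_eq, max_le_iff, abs_le] at this
    exact ⟨this.1, this.2⟩
  · intro ρ τ h
    have h' : ρ.1.1 = τ.1.1 := congrArg (fun z => z.1) h
    exact Subtype.ext (Subtype.ext h')

/-- The fan obtained from a set of rays of magnitude at most `h`. -/
def completionOf {h : ℕ} (S : Set (raysUpTo h)) : Fan :=
  completion (Subtype.val '' S) (Set.toFinite _)

/-- Every set of fans is an event. -/
instance : MeasurableSpace Fan := ⊤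

/-- The distribution `T(h,p)` on fans: every ray of magnitude at most `h` is chosen independently
with probability `p`, and the chosen rays are completed to a fan. -/
noncomputable def T (h : ℕ) (p : unitInterval) : MeasureTheory.Measure Fan :=
  (ProbabilityTheory.setBernoulli (Set.univ : Set (raysUpTo h)) p).map completionOf

instance (h : ℕ) (p : unitInterval) : MeasureTheory.IsProbabilityMeasure (T h p) :=
  MeasureTheory.Measure.isProbabilityMeasure_map Measurable.of_discrete.aemeasurable

end RandomToric

/-! Consider three consecutive rays through $(x,1)$, $(x-1,1)$, $(x-2,1)$ with $x$ close to $h$. A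
lattice point $(a,b)$ strictly between the outer two satisfies $b(x-2)<a<bx$, so $b\ge 1$. If $b=1$
it is the middle point, and if $b\ge 2$ then $a>2(x-2)\ge h$, so its ray is too long to be sampled.
Hence, when the outer rays are chosen and the middle one is not, the completion contains the cone on
the outer two, of determinant $2$ (`isSingular_completionOf`). About $h/6$ disjoint triples of this
kind are available, and each shows the pattern independently with probability $q=p^2(1-p)>0$. The
probability that none does is $(1-q)^K\to 0$ (`one_sub_le_setBernoulli_univ`,
`one_sub_le_T_isSingular`).

A cone of determinant $D\ge 2$ gives a nonregular local ring at the torus-fixed point because its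
embedding dimension exceeds its Krull dimension. Two monomials generate the maximal ideal up to
radical, so by Krull's height theorem the dimension is at most $2$. Three irreducible elements of
the semigroup give three independent cotangent directions. They are detected by a homomorphism to
the square-zero extension of $k$ by $k^3$, so neither the exact dimension nor a Hilbert basis is
needed (`not_isRegularLocalRing_localization`, `exists_not_isRegularLocalRing_coordRing`). -/

namespace RandomToric

/-! ### Regular local rings: Krull dimension against cotangent directions. -/

open IsLocalRing

/-- A Noetherian local ring whose maximal ideal is the radical of an ideal with `n` generators has
dimension at most `n`. -/
theorem ringKrullDim_le_card_of_maximalIdeal_le_radical {R : Type*} [CommRing R] [IsLocalRing R]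
    [IsNoetherianRing R] (s : Finset R) (hs : (s : Set R) ⊆ maximalIdeal R)
    (h : maximalIdeal R ≤ (Ideal.span (s : Set R)).radical) : ringKrullDim R ≤ s.card := by
  rw [← maximalIdeal_height_eq_ringKrullDim]
  have hmin : maximalIdeal R ∈ (Ideal.span (s : Set R)).minimalPrimes := by
    refine ⟨⟨inferInstance, Ideal.span_le.2 hs⟩, ?_⟩
    rintro q ⟨hq, hle⟩ -
    exact h.trans (hq.radical_le_iff.2 hle)
  -- Krull's height theorem.
  exact_mod_cast Ideal.height_le_card_of_mem_minimalPrimes_span_finset hmin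

/-- If a regular local ring `R` admits a ring homomorphism to the square-zero extension of a field
`k` by `k ^ ι` which maps the maximal ideal into `k ^ ι`, hitting every basis vector, then
`dim R ≥ |ι|`. -/
theorem card_le_ringKrullDim_of_isRegularLocalRing {R k ι : Type*} [CommRing R] [Field k]
    [Fintype ι] [DecidableEq ι] [IsRegularLocalRing R] (f : R →+* TrivSqZeroExt k (ι → k))
    (hf : ∀ r ∈ maximalIdeal R, (f r).fst = 0)
    (hf' : ∀ i, ∃ r ∈ maximalIdeal R, (f r).snd = Pi.single i 1) :
    (Fintype.card ι : WithBot ℕ∞) ≤ ringKrullDim R := by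
  classical
  -- Regularity enters only here: the dimension is the minimal number of generators of the maximal
  -- ideal, so the images of a minimal generating set have to span $k^\iota$.
  rw [← IsRegularLocalRing.spanFinrank_maximalIdeal]
  obtain ⟨s, hs, hspan⟩ :=
    (IsNoetherian.noetherian (maximalIdeal R)).exists_span_finset_card_eq_spanFinrank
  rw [← hs]
  have hsub : ∀ r ∈ s, r ∈ maximalIdeal R := fun r hr => hspan ▸ Submodule.subset_span hr
  have key : ∀ r ∈ maximalIdeal R,
      (f r).snd ∈ Submodule.span k ((s.image fun r => (f r).snd : Finset (ι → k)) : Set (ι → k)) := by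
    intro r hr
    have hr' : r ∈ Submodule.span R (s : Set R) := by rwa [hspan]
    induction hr' using Submodule.span_induction with
    | mem x hx => exact Submodule.subset_span (by simpa using ⟨x, hx, rfl⟩)
    | zero => simp
    | add x y hx hy h1 h2 =>
      rw [hspan] at hx hy
      rw [map_add, TrivSqZeroExt.snd_add]
      exact add_mem (h1 hx) (h2 hy)
    | smul a x hx h1 =>
      rw [hspan] at hx
      -- In the Leibniz rule the term carrying the second component of `f a` has the factor `(f
      -- x).fst = 0`, so `a` acts through the scalar `(f a).fst`.
      rw [smul_eq_mul, map_mul, TrivSqZeroExt.snd_mul, hf x hx]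
      simpa using Submodule.smul_mem _ _ (h1 hx)
  have htop : Submodule.span k
      ((s.image fun r => (f r).snd : Finset (ι → k)) : Set (ι → k)) = ⊤ := by
    rw [eq_top_iff, ← (Pi.basisFun k ι).span_eq, Submodule.span_le]
    rintro _ ⟨i, rfl⟩
    obtain ⟨r, hr, h⟩ := hf' i
    rw [Pi.basisFun_apply, ← h]
    exact key r hr
  have h1 := finrank_span_finset_le_card (R := k) (s.image fun r => (f r).snd)
  rw [Set.finrank, htop, finrank_top, Module.finrank_fintype_fun_eq_card] at h1
  exact_mod_cast h1.trans Finset.card_image_le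

/-- The local ring of `A` at a prime `P` which is the radical of an ideal generated by a finite set
`s` is not regular if the cotangent space at `P` surjects onto `k ^ ι` with `|s| < |ι|`. -/
theorem not_isRegularLocalRing_localization {A k ι : Type*} [CommRing A] [Field k]
    [Fintype ι] [DecidableEq ι] (P : Ideal A) [P.IsPrime] (s : Finset A) (hs : (s : Set A) ⊆ P)
    (hP : P ≤ (Ideal.span (s : Set A)).radical) (hι : s.card < Fintype.card ι)
    (f : A →+* TrivSqZeroExt k (ι → k)) (hf : ∀ r, r ∈ P ↔ (f r).fst = 0)
    (hf' : ∀ i, ∃ r ∈ P, (f r).snd = Pi.single i 1) :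
    ¬ IsRegularLocalRing (Localization.AtPrime P) := by
  classical
  intro hreg
  -- An element of a square-zero extension is a unit as soon as its first component is, so `f`
  -- extends to the localization at `P`.
  have hu : ∀ y : P.primeCompl, IsUnit (f y) := fun y => by
    rw [TrivSqZeroExt.isUnit_iff_isUnit_fst, isUnit_iff_ne_zero]
    exact fun h => y.2 ((hf _).2 h)
  have hmap := Localization.AtPrime.map_eq_maximalIdeal (I := P)
  have hdim : ringKrullDim (Localization.AtPrime P) ≤
      (s.image (algebraMap A (Localization.AtPrime P))).card := by
    refine ringKrullDim_le_card_of_maximalIdeal_le_radical _ ?_ ?_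
    · rw [← hmap, Finset.coe_image]
      rintro _ ⟨x, hx, rfl⟩
      exact Ideal.mem_map_of_mem _ (hs hx)
    · rw [← hmap, Finset.coe_image, ← Ideal.map_span]
      exact (Ideal.map_mono hP).trans (Ideal.map_radical_le _)
  have hcard := card_le_ringKrullDim_of_isRegularLocalRing (R := Localization.AtPrime P)
    (IsLocalization.lift hu) (k := k) (ι := ι) ?_ ?_
  · have h1 := hcard.trans hdim
    have h2 : Fintype.card ι ≤ (s.image (algebraMap A (Localization.AtPrime P))).card := by
      exact_mod_cast h1
    exact absurd (h2.trans Finset.card_image_le) (by omega)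
  · intro r hr
    rw [← hmap] at hr
    refine Submodule.span_induction (p := fun r _ => (IsLocalization.lift hu r).fst = 0)
      ?_ (by simp) ?_ ?_ hr
    · rintro _ ⟨x, hx, rfl⟩
      rw [IsLocalization.lift_eq]
      exact (hf x).1 hx
    · intro x y _ _ hx hy
      rw [map_add, TrivSqZeroExt.fst_add, hx, hy, add_zero]
    · intro a x _ hx
      rw [smul_eq_mul, map_mul, TrivSqZeroExt.fst_mul, hx, mul_zero]
  · intro i
    obtain ⟨r, hr, h⟩ := hf' i
    refine ⟨algebraMap _ _ r, hmap ▸ Ideal.mem_map_of_mem _ hr, ?_⟩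
    rw [IsLocalization.lift_eq, h]

end RandomToric

/-! ### Independence of disjoint blocks in a Bernoulli random set. -/

namespace RandomToric

open MeasureTheory ProbabilityTheory unitInterval

/-- Along an injective family `f : α × κ → ι`, the traces of a Bernoulli random subset of `ι` on the
blocks `{a} × κ` are independent Bernoulli random subsets of `κ`. -/
theorem setBernoulli_univ_forall_block {α κ ι : Type*} [Fintype α] [Finite κ] [Finite ι] (p : I)
    {f : α × κ → ι} (hf : Function.Injective f) (B : Set (Set κ)) :
    setBernoulli (Set.univ : Set ι) p {S | ∀ a, {j | f (a, j) ∈ S} ∈ B} =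
      setBernoulli (Set.univ : Set κ) p B ^ Fintype.card α := by
  -- The law of one coordinate: membership viewed as a random proposition, true with probability
  -- `p`. Restricting the product of copies of `ν` along `f` and currying yields a product of
  -- products, and this is the independence of the blocks.
  set ν : Measure Prop := toNNReal p • Measure.dirac True + toNNReal (σ p) • Measure.dirac False
    with hν
  have hprob : IsProbabilityMeasure ν := by
    have : IsProbabilityMeasure (toNNReal p • Measure.dirac ((0 : ℕ) ∈ Set.univ) +
      toNNReal (σ p) • Measure.dirac False) := inferInstance
    simpa [hν] using this
  have hB : MeasurableSet ((fun q : κ → Prop => {j | q j}) ⁻¹' B) := .of_discrete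
  rw [setBernoulli_apply', setBernoulli_apply']
  simp only [Set.mem_univ, ← hν]
  rw [← Finset.card_univ, ← Finset.prod_const,
    ← Measure.infinitePi_pi (fun _ : α => Measure.infinitePi fun _ : κ => ν)
      (s := Finset.univ) (t := fun _ => (fun q : κ → Prop => {j | q j}) ⁻¹' B) (fun _ _ => hB),
    ← Measure.infinitePi_map_curry (fun (_ : α) (_ : κ) => ν),
    ← Measure.map_infinitePi_infinitePi_of_inj (P := fun _ : ι => ν) hf,
    Measure.map_apply (by fun_prop) (.pi (Set.to_countable _) fun _ _ => hB),
    Measure.map_apply (by fun_prop) .of_discrete]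
  congr 1
  ext q
  simp [Set.mem_pi]

/-- If the event `A` happens as soon as the random set traces `t` on one of the blocks of an
injective family, then its probability is at least `1 - (1 - P(t)) ^ |α|`. -/
theorem one_sub_le_setBernoulli_univ {α κ ι : Type*} [Fintype α] [Finite κ] [Finite ι] (p : I)
    {f : α × κ → ι} (hf : Function.Injective f) (t : Set κ) (A : Set (Set ι))
    (hA : ∀ S a, {j | f (a, j) ∈ S} = t → S ∈ A) :
    1 - (1 - setBernoulli (Set.univ : Set κ) p {t}) ^ Fintype.card α ≤
      setBernoulli (Set.univ : Set ι) p A := by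
  have h := setBernoulli_univ_forall_block p hf ({t}ᶜ : Set (Set κ))
  rw [prob_compl_eq_one_sub .of_discrete] at h
  rw [← h, tsub_le_iff_left, ← prob_add_prob_compl (μ := setBernoulli (Set.univ : Set ι) p)
    (s := A) .of_discrete, add_comm]
  -- Outside `A` no block has trace `t`, so the complement of `A` lies in the event whose
  -- probability was just computed.
  gcongr
  intro S hS a ha
  exact hS (hA S a ha)

end RandomToric

/-! ### Nonregular points of semigroup algebras. -/

namespace RandomToric

open CategoryTheory AlgebraicGeometry

/-- The homomorphism from a semigroup algebra to a square-zero extension given by a family of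
irreducible elements of the semigroup. -/
noncomputable def irreducibleHom {M ι : Type*} (k : Type*) [AddCommMonoid M] [DecidableEq M]
    [Field k] (e : ι → M) (hpos : ∀ s t : M, s + t = 0 → s = 0)
    (he : ∀ i s t, s + t = e i → s = 0 ∨ t = 0) :
    AddMonoidAlgebra k M →ₐ[k] TrivSqZeroExt k (ι → k) :=
  AddMonoidAlgebra.lift k (TrivSqZeroExt k (ι → k)) M
    { toFun s := if s.toAdd = 0 then 1 else
        TrivSqZeroExt.inr fun i => if s.toAdd = e i then 1 else 0
      map_one' := by simp
      map_mul' := by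
        intro s t
        rw [toAdd_mul]
        by_cases hs : s.toAdd = 0
        · simp [hs]
        by_cases ht : t.toAdd = 0
        · simp [ht]
        -- For nonzero `s` and `t` the product of the images vanishes since the ideal squares to
        -- zero, and `s + t` also maps to zero because it is no irreducible `e i`.
        rw [if_neg hs, if_neg ht, if_neg fun h => hs (hpos _ _ h), TrivSqZeroExt.inr_mul_inr]
        ext
        · simp
        · simp only [TrivSqZeroExt.snd_inr, TrivSqZeroExt.snd_zero, Pi.zero_apply]
          exact if_neg fun h => (he _ _ _ h).elim hs ht }

/-- Let `M` be a monoid without nontrivial units which is, up to radicals, generated by a finite set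
`G`. If `M` has more than `|G|` irreducible elements, then `k[M]` is not regular at the ideal
spanned by the nonzero elements of `M`. -/
theorem exists_not_isRegularLocalRing_localization {M k ι : Type*} [AddCommMonoid M] [Field k]
    [Fintype ι] (e : ι → M) (hpos : ∀ s t : M, s + t = 0 → s = 0) (he0 : ∀ i, e i ≠ 0)
    (he : ∀ i s t, s + t = e i → s = 0 ∨ t = 0) (hinj : Function.Injective e)
    (G : Finset M) (hG0 : 0 ∉ G) (hG : ∀ s : M, s ≠ 0 → ∃ n : ℕ, ∃ g ∈ G, ∃ t, n • s = g + t)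
    (hcard : G.card < Fintype.card ι) :
    ∃ (P : Ideal (AddMonoidAlgebra k M)) (_ : P.IsPrime),
      ¬ IsRegularLocalRing (Localization.AtPrime P) := by
  classical
  let f := irreducibleHom k e hpos he
  have hf0 : ∀ c : k, f (AddMonoidAlgebra.single 0 c) = TrivSqZeroExt.inl c := by
    intro c
    simp [f, irreducibleHom, Algebra.smul_def, TrivSqZeroExt.algebraMap_eq_inl]
  have hf : ∀ (s : M) (c : k), s ≠ 0 → f (AddMonoidAlgebra.single s c) =
      c • TrivSqZeroExt.inr fun i => if s = e i then 1 else 0 := by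
    intro s c hs
    simp [f, irreducibleHom, hs]
  let g : AddMonoidAlgebra k M →ₐ[k] k := (TrivSqZeroExt.fstHom k k (ι → k)).comp f
  have hg : ∀ r, g r = (f r).fst := fun r => rfl
  let I : Ideal (AddMonoidAlgebra k M) :=
    Ideal.span (G.image fun s => AddMonoidAlgebra.single s (1 : k) : Finset _)
  -- Subtracting the augmentation makes the claim additive in `r`, so it may be checked on
  -- monomials; membership in the kernel of `g` would not pass to the summands.
  have hrad : ∀ r, r - AddMonoidAlgebra.single 0 (g r) ∈ I.radical := by
    intro r
    induction r using AddMonoidAlgebra.induction_linear with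
    | zero => simp
    | add x y hx hy =>
      rw [map_add, AddMonoidAlgebra.single_add, add_sub_add_comm]
      exact add_mem hx hy
    | single s c =>
      by_cases hs : s = 0
      · subst hs
        rw [hg, hf0]
        simp
      · rw [hg, hf s c hs]
        obtain ⟨n, a, ha, t, hn⟩ := hG s hs
        simp only [TrivSqZeroExt.fst_smul, TrivSqZeroExt.fst_inr, smul_zero,
          AddMonoidAlgebra.single_zero, sub_zero]
        refine ⟨n, ?_⟩
        have hmem : AddMonoidAlgebra.single a (1 : k) ∈ I :=
          Ideal.subset_span (Finset.mem_coe.2 (Finset.mem_image_of_mem _ ha))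
        rw [AddMonoidAlgebra.single_pow, hn, ← one_mul (c ^ n),
          ← AddMonoidAlgebra.single_mul_single]
        exact I.mul_mem_right _ hmem
  refine ⟨RingHom.ker g, RingHom.ker_isPrime _, ?_⟩
  have := RingHom.ker_isPrime g
  refine not_isRegularLocalRing_localization (RingHom.ker g)
    (G.image fun s => AddMonoidAlgebra.single s (1 : k)) ?_ ?_
    (Finset.card_image_le.trans_lt hcard) f.toRingHom (fun r => Iff.rfl) ?_
  · rw [Finset.coe_image]
    rintro _ ⟨s, hs, rfl⟩
    have hs0 : s ≠ 0 := fun h => hG0 (h ▸ hs)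
    change g _ = 0
    rw [hg, hf s 1 hs0]
    simp
  · intro r hr
    have h := hrad r
    rwa [show g r = 0 from hr, AddMonoidAlgebra.single_zero, sub_zero] at h
  · intro i
    refine ⟨AddMonoidAlgebra.single (e i) 1, ?_, ?_⟩
    · change g _ = 0
      rw [hg, hf _ 1 (he0 i)]
      simp
    · change (f _).snd = _
      rw [hf _ 1 (he0 i)]
      ext j
      simp [Pi.single_apply, hinj.eq_iff, eq_comm]

/-! ### The dual semigroup of a two-dimensional cone. -/

theorem pairing_toReal (m u : ℤ × ℤ) :
    pairing m (toReal u) = ((m.1 * u.1 + m.2 * u.2 : ℤ) : ℝ) := by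
  simp [pairing, toReal]

/-- Nonnegativity of a linear form on a cone can be tested on its generators, which leaves two
integer inequalities. -/
theorem mem_dualMonoid_cone₂ {ρ τ : Ray} {m : ℤ × ℤ} : m ∈ dualMonoid (cone₂ ρ τ) ↔
    0 ≤ m.1 * ρ.1.1 + m.2 * ρ.1.2 ∧ 0 ≤ m.1 * τ.1.1 + m.2 * τ.1.2 := by
  have h : ∀ υ : Ray, 0 ≤ pairing m υ.vec ↔ 0 ≤ m.1 * υ.1.1 + m.2 * υ.1.2 := by
    intro υ
    rw [Ray.vec, pairing_toReal]
    exact Int.cast_nonneg_iff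
  rw [← h, ← h]
  constructor
  · exact fun hm => ⟨hm _ (vec_left_mem _ _), hm _ (vec_right_mem _ _)⟩
  · rintro ⟨h1, h2⟩ x hx
    obtain ⟨a, b, ha, hb, rfl⟩ := mem_hull_two.1 hx
    have e : pairing m (a • ρ.vec + b • τ.vec) = a * pairing m ρ.vec + b * pairing m τ.vec := by
      simp [pairing]; ring
    rw [e]
    positivity

/-- The affine toric surface of a cone of multiplicity at least `2` has a nonregular local ring. -/
theorem exists_not_isRegularLocalRing_coordRing {ρ τ : Ray}
    (h : 2 ≤ ρ.1.1 * τ.1.2 - ρ.1.2 * τ.1.1) :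
    ∃ (P : Ideal (CoordRing (cone₂ ρ τ))) (_ : P.IsPrime),
      ¬ IsRegularLocalRing (Localization.AtPrime P) := by
  classical
  obtain ⟨⟨a, b⟩, i, j, hij⟩ := ρ
  obtain ⟨⟨c, d⟩, k, l, hkl⟩ := τ
  set ρ : Ray := ⟨(a, b), i, j, hij⟩
  set τ : Ray := ⟨(c, d), k, l, hkl⟩
  change 2 ≤ a * d - b * c at h
  change i * a + j * b = 1 at hij
  change k * c + l * d = 1 at hkl
  set D := a * d - b * c with hD
  -- The coordinates $(u,v)$ embed the dual semigroup into $\mathbb{N}^2$; `h1` and `h2` are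
  -- Cramer's rule for recovering `m`.
  let u : ℤ × ℤ → ℤ := fun m => m.1 * a + m.2 * b
  let v : ℤ × ℤ → ℤ := fun m => m.1 * c + m.2 * d
  have huadd : ∀ m n, u (m + n) = u m + u n := fun m n => by
    simp only [u, Prod.fst_add, Prod.snd_add]; ring
  have hvadd : ∀ m n, v (m + n) = v m + v n := fun m n => by
    simp only [v, Prod.fst_add, Prod.snd_add]; ring
  have hmem : ∀ m : ℤ × ℤ, m ∈ dualMonoid (cone₂ ρ τ) ↔ 0 ≤ u m ∧ 0 ≤ v m :=
    fun m => mem_dualMonoid_cone₂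
  have h1 : ∀ m : ℤ × ℤ, D * m.1 = u m * d - v m * b := fun m => by simp only [u, v, hD]; ring
  have h2 : ∀ m : ℤ × ℤ, D * m.2 = v m * a - u m * c := fun m => by simp only [u, v, hD]; ring
  have hzero : ∀ m : ℤ × ℤ, u m = 0 → v m = 0 → m = 0 := by
    intro m hu hv
    have e1 := h1 m
    have e2 := h2 m
    rw [hu, hv] at e1 e2
    ext
    · exact (mul_eq_zero.1 (e1.trans (by ring))).resolve_left (by omega)
    · exact (mul_eq_zero.1 (e2.trans (by ring))).resolve_left (by omega)
  -- Primitivity of `ρ`: the Bézout relation $ia+jb=1$ combines the two Cramer identities into a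
  -- multiple of `D`.
  have hdvdv : ∀ m : ℤ × ℤ, u m = 0 → D ∣ v m := by
    intro m hu
    have e1 := h1 m
    have e2 := h2 m
    rw [hu] at e1 e2
    exact ⟨i * m.2 - j * m.1, by linear_combination -v m * hij - i * e2 + j * e1⟩
  have hdvdu : ∀ m : ℤ × ℤ, v m = 0 → D ∣ u m := by
    intro m hv
    have e1 := h1 m
    have e2 := h2 m
    rw [hv] at e1 e2
    exact ⟨l * m.1 - k * m.2, by linear_combination -u m * hkl + k * e2 - l * e1⟩
  let α : ℤ × ℤ := (-b, a)
  let β : ℤ × ℤ := (d, -c)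
  -- In coordinates $(u,v)$ one has $\alpha=(0,D)$, $\beta=(D,0)$ and $\gamma=(1,r)$. The Bézout
  -- vector $(i,j)$ has $u=1$, and subtracting a multiple of `α` reduces its `v` modulo `D`. Here
  -- $0<r<D$, as $r=0$ would force $D\mid 1$.
  let γ : ℤ × ℤ := (i + b * ((i * c + j * d) / D), j - a * ((i * c + j * d) / D))
  have huα : u α = 0 := by simp only [u, α]; ring
  have hvα : v α = D := by simp only [v, α, hD]; ring
  have huβ : u β = D := by simp only [u, β, hD]; ring
  have hvβ : v β = 0 := by simp only [v, β]; ring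
  have huγ : u γ = 1 := by simp only [u, γ]; linear_combination hij
  have hvγ : v γ = (i * c + j * d) % D := by
    rw [Int.emod_def]; simp only [v, γ, hD]; ring
  have hvγ0 : 0 < v γ := by
    refine lt_of_le_of_ne (hvγ ▸ Int.emod_nonneg _ (by omega)) fun h0 => ?_
    have := Int.le_of_dvd one_pos (huγ ▸ hdvdu γ h0.symm)
    omega
  have hvγ1 : v γ < D := hvγ ▸ Int.emod_lt_of_pos _ (by omega)
  let e : Fin 3 → dualMonoid (cone₂ ρ τ) := ![⟨α, (hmem α).2 ⟨by omega, by omega⟩⟩,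
    ⟨β, (hmem β).2 ⟨by omega, by omega⟩⟩, ⟨γ, (hmem γ).2 ⟨by omega, by omega⟩⟩]
  have hu0 : u 0 = 0 := by simp [u]
  have hv0 : v 0 = 0 := by simp [v]
  have small : ∀ x : ℤ, D ∣ x → 0 ≤ x → x < D → x = 0 := fun x h1 h2 h3 =>
    Int.eq_zero_of_dvd_of_nonneg_of_lt h2 h3 h1
  refine exists_not_isRegularLocalRing_localization e ?_ ?_ ?_ ?_ {e 0, e 1} ?_ ?_ ?_
  · rintro ⟨s, hs⟩ ⟨t, ht⟩ hst
    have hst : s + t = 0 := congrArg Subtype.val hst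
    rw [hmem] at hs ht
    have e1 := huadd s t
    have e2 := hvadd s t
    rw [hst] at e1 e2
    exact Subtype.ext (hzero s (by omega) (by omega))
  · intro i hi
    have hi : (e i).1 = 0 := congrArg Subtype.val hi
    fin_cases i
    · have : v α = 0 := by rw [show α = 0 from hi, hv0]
      omega
    · have : u β = 0 := by rw [show β = 0 from hi, hu0]
      omega
    · have : u γ = 0 := by rw [show γ = 0 from hi, hu0]
      omega
  · rintro i ⟨s, hs⟩ ⟨t, ht⟩ hst
    have hst : s + t = (e i).1 := congrArg Subtype.val hst
    rw [hmem] at hs ht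
    have e1 := huadd s t
    have e2 := hvadd s t
    rw [hst] at e1 e2
    suffices H : s = 0 ∨ t = 0 from H.imp (fun h => Subtype.ext h) (fun h => Subtype.ext h)
    fin_cases i
    · change u α = _ at e1
      change v α = _ at e2
      rcases lt_or_ge (v s) D with hlt | hge
      · exact Or.inl (hzero s (by omega) (small _ (hdvdv s (by omega)) hs.2 hlt))
      · exact Or.inr (hzero t (by omega) (by omega))
    · change u β = _ at e1
      change v β = _ at e2
      rcases lt_or_ge (u s) D with hlt | hge
      · exact Or.inl (hzero s (small _ (hdvdu s (by omega)) hs.1 hlt) (by omega))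
      · exact Or.inr (hzero t (by omega) (by omega))
    · change u γ = _ at e1
      change v γ = _ at e2
      -- Since $u(\gamma)=1$, one summand has $u=0$; its `v` is then a multiple of `D` below `D`,
      -- hence zero.
      rcases (show u s = 0 ∨ u t = 0 by omega) with h0 | h0
      · exact Or.inl (hzero s h0 (small _ (hdvdv s h0) hs.2 (by omega)))
      · exact Or.inr (hzero t h0 (small _ (hdvdv t h0) ht.2 (by omega)))
  · have hval : Function.Injective fun i => u (e i).1 := by
      have hval : (fun i => u (e i).1) = ![0, D, 1] := by
        ext i
        fin_cases i
        · exact huα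
        · exact huβ
        · exact huγ
      rw [hval]
      intro x y
      fin_cases x <;> fin_cases y <;> simp <;> omega
    exact fun x y hxy => hval (by simp only [hxy])
  · simp only [Finset.mem_insert, Finset.mem_singleton, not_or]
    constructor
    · intro h0
      have : v α = 0 := by rw [show (0 : ℤ × ℤ) = α from congrArg Subtype.val h0] at hv0; exact hv0
      omega
    · intro h0
      have : u β = 0 := by rw [show (0 : ℤ × ℤ) = β from congrArg Subtype.val h0] at hu0; exact hu0
      omega
  · rintro s hs0
    obtain ⟨hu, hv⟩ := (hmem s.1).1 s.2
    obtain ⟨x, hx⟩ := Int.eq_ofNat_of_zero_le hu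
    obtain ⟨y, hy⟩ := Int.eq_ofNat_of_zero_le hv
    -- This is $Ds=u(s)\beta+v(s)\alpha$. For $s\ne 0$ a coefficient is positive, so `D` copies of
    -- `s` contain `α` or `β` as a summand.
    have hrel : D.toNat • s = x • e 1 + y • e 0 := by
      have hDn : (D.toNat : ℤ) = D := Int.toNat_of_nonneg (by omega)
      apply Subtype.ext
      change D.toNat • s.1 = x • β + y • α
      ext
      · change D.toNat • s.1.1 = x • d + y • (-b)
        simp only [nsmul_eq_mul, hDn, h1, hx, hy]; ring
      · change D.toNat • s.1.2 = x • (-c) + y • a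
        simp only [nsmul_eq_mul, hDn, h2, hx, hy]; ring
    refine ⟨D.toNat, ?_⟩
    rw [hrel]
    rcases x with _ | x
    · rcases y with _ | y
      · exact absurd (Subtype.ext (hzero _ hx hy)) hs0
      · exact ⟨e 0, by simp, y • e 0, by rw [zero_smul, zero_add, succ_nsmul']⟩
    · exact ⟨e 1, by simp, x • e 1 + y • e 0, by rw [succ_nsmul', add_assoc]⟩
  · exact Finset.card_le_two.trans_lt (by simp)

/-! ### From local rings of affine charts to the glued scheme. -/

theorem isSingular_Spec_of_not_isRegularLocalRing {A : Type} [CommRing A] (P : Ideal A) [P.IsPrime]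
    (h : ¬ IsRegularLocalRing (Localization.AtPrime P)) : IsSingular (Spec (CommRingCat.of A)) :=
  ⟨⟨P, inferInstance⟩, fun _ => h (IsRegularLocalRing.of_ringEquiv
    (Spec.stalkIso (CommRingCat.of A) ⟨P, inferInstance⟩).commRingCatIsoToRingEquiv)⟩

/-- Open immersions are isomorphisms on stalks, so a nonregular point of a chart stays nonregular
after gluing. -/
theorem IsSingular.of_isOpenImmersion {X Y : Scheme.{0}} (f : X ⟶ Y) [IsOpenImmersion f]
    (h : IsSingular X) : IsSingular Y := by
  obtain ⟨x, hx⟩ := h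
  exact ⟨f x, fun _ => hx (IsRegularLocalRing.of_ringEquiv
    (asIso (f.stalkMap x)).commRingCatIsoToRingEquiv)⟩

/-- A fan with a two-dimensional cone of multiplicity at least `2` has a singular toric variety. -/
theorem isSingular_toricVariety {F : Fan} {ρ τ : Ray} (hF : cone₂ ρ τ ∈ F.cones)
    (h : 2 ≤ ρ.1.1 * τ.1.2 - ρ.1.2 * τ.1.1) : IsSingular (toricVariety F) := by
  obtain ⟨P, hP, hreg⟩ := exists_not_isRegularLocalRing_coordRing h
  change IsSingular (Limits.colimit F.diagram)
  exact IsSingular.of_isOpenImmersion (Limits.colimit.ι F.diagram ⟨cone₂ ρ τ, hF⟩)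
    (isSingular_Spec_of_not_isRegularLocalRing P hreg)

end RandomToric

/-! ### Triples of consecutive rays and the probability bound. -/

namespace RandomToric

open MeasureTheory ProbabilityTheory

/-- The ray spanned by `(x, 1)`. -/
def unitSlopeRay (x : ℤ) : Ray := ⟨(x, 1), isCoprime_one_right⟩

theorem unitSlopeRay_mem_raysUpTo {h : ℕ} {x : ℤ} (hx : 1 ≤ x) (hxh : x ≤ h) :
    unitSlopeRay x ∈ raysUpTo h := by
  change max |x| |(1 : ℤ)| ≤ h
  rw [abs_of_nonneg (by omega), abs_one]
  omega

theorem wedge_vec (ρ τ : Ray) :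
    wedge ρ.vec τ.vec = ((ρ.1.1 * τ.1.2 - ρ.1.2 * τ.1.1 : ℤ) : ℝ) := by
  simp [wedge, Ray.vec, toReal]

/-- If the rays spanned by `(x, 1)` and `(x - 2, 1)` are chosen but not the one spanned by
`(x - 1, 1)`, where `h ≤ 2 (x - 2)`, then the completion has a singular toric variety. -/
theorem isSingular_completionOf {h : ℕ} {S : Set (raysUpTo h)} {x : ℤ} (hx : (h : ℤ) ≤ 2 * (x - 2))
    {r : ℤ → raysUpTo h} (hr : ∀ j ∈ Set.Icc 0 2, (r j).1 = unitSlopeRay (x - j))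
    (h0 : r 0 ∈ S) (h1 : r 1 ∉ S) (h2 : r 2 ∈ S) :
    IsSingular (toricVariety (completionOf S)) := by
  have e0 : (r 0).1 = unitSlopeRay x := by rw [hr 0 (by simp), sub_zero]
  have e1 := hr 1 (by simp)
  have e2 := hr 2 (by simp)
  have hF : cone₂ (unitSlopeRay x) (unitSlopeRay (x - 2)) ∈ (completionOf S).cones := by
    refine Or.inr (Or.inr ⟨_, ⟨_, h0, e0⟩, _, ⟨_, h2, e2⟩, ?_, ?_, rfl⟩)
    · rw [wedge_vec]
      simp [unitSlopeRay]
    · rintro _ ⟨ω, hω, rfl⟩ ⟨hl, hu⟩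
      rw [wedge_vec, Int.cast_pos] at hl hu
      simp only [unitSlopeRay, one_mul, mul_one] at hl hu
      have hb : ω.1.1.1 ≤ h := (le_abs_self _).trans ((le_max_left _ _).trans ω.2)
      have hpos : 1 ≤ ω.1.1.2 := by nlinarith
      -- At height one only the excluded middle ray fits; at height at least two the first
      -- coordinate would exceed $2(x-2)\ge h$.
      rcases hpos.eq_or_lt with h' | h'
      · rw [← h'] at hl hu
        refine h1 ?_
        have : r 1 = ω := by
          apply Subtype.ext
          rw [e1]
          exact Subtype.ext (Prod.ext (by simp only [unitSlopeRay]; omega) h')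
        exact this ▸ hω
      · nlinarith
  exact isSingular_toricVariety hF (by simp [unitSlopeRay])

/-- The lower bound for the probability of a singular toric variety that results from `K` disjoint
blocks of three consecutive rays. -/
theorem one_sub_le_T_isSingular {K h : ℕ} (hK : 6 * K + 4 ≤ h) (p : unitInterval) :
    1 - (1 - setBernoulli (Set.univ : Set (Fin 3)) p {{0, 2}}) ^ K ≤
      T h p {F | IsSingular (toricVariety F)} := by
  have hmem : ∀ (k : Fin K) (j : Fin 3),
      unitSlopeRay ((h : ℤ) - 3 * (k : ℕ) - (j : ℕ)) ∈ raysUpTo h := fun k j =>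
    unitSlopeRay_mem_raysUpTo (by omega) (by omega)
  let f : Fin K × Fin 3 → raysUpTo h := fun i => ⟨_, hmem i.1 i.2⟩
  have hf : Function.Injective f := by
    rintro ⟨k, j⟩ ⟨k', j'⟩ hkj
    have : (h : ℤ) - 3 * (k : ℕ) - (j : ℕ) = (h : ℤ) - 3 * (k' : ℕ) - (j' : ℕ) :=
      congrArg (fun z : raysUpTo h => z.1.1.1) hkj
    ext <;> simp only <;> omega
  have key := one_sub_le_setBernoulli_univ p hf {0, 2}
    {S | IsSingular (toricVariety (completionOf S))} ?_
  · rw [Fintype.card_fin] at key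
    rwa [T, Measure.map_apply .of_discrete MeasurableSpace.measurableSet_top]
  · intro S k hS
    have hS' : ∀ j, f (k, j) ∈ S ↔ j ∈ ({0, 2} : Set (Fin 3)) := fun j => Set.ext_iff.1 hS j
    -- With $x=h-3k$ the requirement $h\le 2(x-2)$ reads $6k+4\le h$, which is the source of the
    -- bound on `K`. The conversion to `Fin 3` matters only for the offsets $0,1,2$.
    refine isSingular_completionOf (x := (h : ℤ) - 3 * (k : ℕ)) (by omega)
      (r := fun j => f (k, Fin.ofNat 3 j.toNat)) ?_ ?_ ?_ ?_
    · rintro j ⟨hj0, hj2⟩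
      interval_cases j <;> rfl
    · exact (hS' 0).2 (by simp)
    · exact fun h => absurd ((hS' 1).1 h) (by simp)
    · exact (hS' 2).2 (by simp)

end RandomToric

/-! ### Passage to the limit. -/

theorem corollary1p2 (p : ℝ) (hp0 : 0 < p) (hp1 : p < 1) :
    Filter.Tendsto
      (fun h : ℕ => RandomToric.T h ⟨p, hp0.le, hp1.le⟩
        {F : RandomToric.Fan | RandomToric.IsSingular (RandomToric.toricVariety F)})
      Filter.atTop (nhds 1) := by
  set I : unitInterval := ⟨p, hp0.le, hp1.le⟩
  have hq : ProbabilityTheory.setBernoulli (Set.univ : Set (Fin 3)) I {{0, 2}} ≠ 0 := by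
    rw [ProbabilityTheory.setBernoulli_singleton I (Set.subset_univ _) Set.finite_univ]
    have h1 : unitInterval.toNNReal I ≠ 0 := fun h => hp0.ne' (congrArg NNReal.toReal h)
    have h2 : unitInterval.toNNReal (unitInterval.symm I) ≠ 0 := fun h =>
      (sub_pos.2 hp1).ne' (congrArg NNReal.toReal h)
    exact mul_ne_zero (pow_ne_zero _ (by exact_mod_cast h1)) (pow_ne_zero _ (by exact_mod_cast h2))
  set q := ProbabilityTheory.setBernoulli (Set.univ : Set (Fin 3)) I {{0, 2}}
  -- The exponent is the largest `K` with $6K+4\le h$. Subtraction is truncated, so the comparison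
  -- below is made only for $h\ge 4$.
  have hlim : Filter.Tendsto (fun h : ℕ => 1 - (1 - q) ^ ((h - 4) / 6)) Filter.atTop (nhds 1) := by
    have hdiv : Filter.Tendsto (fun h : ℕ => (h - 4) / 6) Filter.atTop Filter.atTop :=
      (Nat.tendsto_div_const_atTop (by norm_num)).comp (Filter.tendsto_sub_atTop_nat 4)
    have hpow := (ENNReal.tendsto_pow_atTop_nhds_zero_of_lt_one
      (ENNReal.sub_lt_self ENNReal.one_ne_top one_ne_zero hq)).comp hdiv
    simpa using ENNReal.Tendsto.sub tendsto_const_nhds hpow (Or.inl ENNReal.one_ne_top)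
  refine tendsto_of_tendsto_of_tendsto_of_le_of_le' hlim tendsto_const_nhds ?_
    (Filter.Eventually.of_forall fun h => MeasureTheory.prob_le_one)
  filter_upwards [Filter.eventually_ge_atTop 4] with h hh
  exact RandomToric.one_sub_le_T_isSingular (by omega) I
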